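/- Let $G$ be a (finite-dimensional, real, second countable) Lie group with Lie algebra $\mathfrak g=T_1G$, whose bracket $[\cdot,\cdot]_{\mathfrak g}$ is the usual one (the commutator of left-invariant vector fields). Let $G$ act smoothly and transitively from the left on a smooth manifold $M$, let $o\in M$ and let $H=\{h\in G : h\cdot o=o\}$, so that $M=G/H$. A post-Lie algebra over a field is a vector space $A$ with a Lie bracket $[\cdot,\cdot]$ and a bilinear product $\rhd$ such that, for all $x,y,z\in A$, $$x\rhd[y,z]=[x\rhd y,z]+[y,x\rhd z],\qquad [x,y]\rhd z=a(x,y,z)-a(y,x,z),$$ where $a(x,y,z)=x\rhd(y\rhd z)-(x\rhd y)\rhd z$. For smooth maps $x,y\colon G\to\mathfrak g$ put $[x,y](g)=[x(g),y(g)]_{\mathfrak g}$ and let $x\,\tilde\rhd\,y$ be the derivative of $y$ along the vector field $\rho_*(x)(g)=\frac{\partial}{\partial t}\big|_{t=0}\,g\exp(t\,x(g))=TL_g\,x(g)$ on $G$. Let $$\Omega^0_H(G,\mathfrak g)=\{x\colon G\to\mathfrak g\ \text{smooth} : x(gh)=\mathrm{Ad}_{h^{-1}}x(g)\ \text{for all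 } g\in G,\ h\in H\}.$$ Then $\Omega^0_H(G,\mathfrak g)$ is closed under $[\cdot,\cdot]$ and $\tilde\rhd$, and $\{\Omega^0_H(G,\mathfrak g),[\cdot,\cdot],\tilde\rhd\}$ is a post-Lie algebra over $\mathbb R$. Moreover, let $G\times_H\mathfrak g\to M$, $[(g,v)]\mapsto g\cdot o$, be the Atiyah bundle, where $G\times_H\mathfrak g$ is the quotient of $G\times\mathfrak g$ by $(g,v)\sim(gh,\mathrm{Ad}_{h^{-1}}v)$, $h\in H$, with its fibrewise vector space structure, and let $\Gamma(G\times_H\mathfrak g)$ be its space of smooth sections, that is, those sections $X$ such that for every smooth local section $\sigma\colon U\to G$ of $g\mapsto g\cdot o$ over an open set $U\subseteq M$ one has $X(u)=[(\sigma(u),f(u))]$ on $U$ with $f\colon U\to\mathfrak g$ smooth. There is a linear isomorphism $\Phi\colon\Omega^0_H(G,\mathfrak g)\to\Gamma(G\times_H\mathfrak g)$ with $\Phi(x)(g\cdot o)=[(g,x(g))]$ for all $g\in G$, and $\Gamma(G\times_H\mathfrak g)$ with the bracket and the product transported by $\Phi$ is a post-Lie algebra. -/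

import Mathlib

open scoped Manifold ContDiff

/-! ### Post-Lie algebras -/

/-- `br` is a Lie bracket on the `k`-vector space `A`. -/
structure IsLieBracket (k : Type*) {A : Type*} [Field k] [AddCommGroup A] [Module k A]
    (br : A → A → A) : Prop where
  add_left : ∀ x y z, br (x + y) z = br x z + br y z
  smul_left : ∀ (c : k) x y, br (c • x) y = c • br x y
  add_right : ∀ x y z, br x (y + z) = br x y + br x z
  smul_right : ∀ (c : k) x y, br x (c • y) = c • br x y
  self : ∀ x, br x x = 0
  jacobi : ∀ x y z, br (br x y) z + br (br y z) x + br (br z x) y = 0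

/-- The (negative) associator `x * (y * z) - (x * y) * z` of a product. -/
def productAssociator {A : Type*} [AddCommGroup A] (tr : A → A → A) (x y z : A) : A :=
  tr x (tr y z) - tr (tr x y) z

/-- `(A, br, tr)` is a post-Lie algebra over `k`: `br` is a Lie bracket, `tr` is a bilinear
product, `tr x` is a derivation of `br`, and `[x, y] ▷ z = a(x, y, z) - a(y, x, z)`. -/
structure IsPostLie (k : Type*) {A : Type*} [Field k] [AddCommGroup A] [Module k A]
    (br tr : A → A → A) : Prop where
  lie : IsLieBracket k br
  add_left : ∀ x y z, tr (x + y) z = tr x z + tr y z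
  smul_left : ∀ (c : k) x y, tr (c • x) y = c • tr x y
  add_right : ∀ x y z, tr x (y + z) = tr x y + tr x z
  smul_right : ∀ (c : k) x y, tr x (c • y) = c • tr x y
  derivation : ∀ x y z, tr x (br y z) = br (tr x y) z + br y (tr x z)
  bracket_tr : ∀ x y z,
    tr (br x y) z = productAssociator tr x y z - productAssociator tr y x z

noncomputable section

namespace AtiyahPostLie

variable {E : Type*} [NormedAddCommGroup E] [NormedSpace ℝ E]
  {B : Type*} [TopologicalSpace B] {I : ModelWithCorners ℝ E B}
  {G : Type*} [TopologicalSpace G] [ChartedSpace B G] [Group G]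

/-! ### Functions from a Lie group to its Lie algebra

`GroupLieAlgebra I G` is the tangent space of `G` at `1`; its underlying normed space is the model
space `E`, and smoothness of a map into it is smoothness of a map into `E`. -/

/-- The adjoint representation: the derivative at `1` of `a ↦ g * a * g⁻¹`. -/
def Ad (g : G) (v : GroupLieAlgebra I G) : GroupLieAlgebra I G :=
  mfderiv I I (fun a : G => g * a * g⁻¹) 1 v

variable (I G) in
/-- The space of smooth maps from `G` to its Lie algebra. -/
def smoothFunctions : Submodule ℝ (G → GroupLieAlgebra I G) where
  carrier := {x | ContMDiff I 𝓘(ℝ, E) ∞ (M' := E) x}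
  zero_mem' := contMDiff_const (c := (0 : E))
  add_mem' {x y} hx hy := ContMDiff.add (G := E) (f := x) (g := y) hx hy
  smul_mem' c _ hx :=
    (contDiff_const_smul (𝕜 := ℝ) (F := E) (n := ∞) c).contMDiff.comp (I' := 𝓘(ℝ, E)) hx

/-- The vector field `ρ_*(x)` on `G`, whose value at `g` is the image of `x g` under the derivative
of the left translation by `g` (the derivative at `t = 0` of `g * exp (t • x g)`). -/
def rhoStar (x : G → GroupLieAlgebra I G) (g : G) : TangentSpace I g :=
  mulInvariantVectorField (x g) g

/-- The product `x ▷ y = ρ_*(x)(y)`: the derivative of `y` along the vector field `ρ_*(x)`. -/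
def triangle (x y : G → GroupLieAlgebra I G) (g : G) : GroupLieAlgebra I G :=
  mfderiv I 𝓘(ℝ, E) (M' := E) y g (rhoStar x g)

/-- The pointwise bracket of functions with values in the Lie algebra. -/
def bracket (x y : G → GroupLieAlgebra I G) (g : G) : GroupLieAlgebra I G :=
  ⁅x g, y g⁆

theorem Ad_add (g : G) (v w : GroupLieAlgebra I G) : Ad g (v + w) = Ad g v + Ad g w :=
  map_add (mfderiv I I (fun a : G => g * a * g⁻¹) 1) v w

theorem Ad_smul (g : G) (c : ℝ) (v : GroupLieAlgebra I G) : Ad g (c • v) = c • Ad g v :=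
  map_smul (mfderiv I I (fun a : G => g * a * g⁻¹) 1) c v

theorem Ad_zero (g : G) : Ad g (0 : GroupLieAlgebra I G) = 0 :=
  map_zero (mfderiv I I (fun a : G => g * a * g⁻¹) 1)

variable (I) in
/-- The space of smooth functions `x` from `G` to its Lie algebra which are equivariant under the
subgroup `H`: `x (g * h) = Ad_{h⁻¹} (x g)`. -/
def equivariantFunctions (H : Subgroup G) : Submodule ℝ (G → GroupLieAlgebra I G) where
  carrier := {x | x ∈ smoothFunctions I G ∧ ∀ g : G, ∀ h ∈ H, x (g * h) = Ad h⁻¹ (x g)}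
  zero_mem' := ⟨zero_mem _, fun _ h _ => (Ad_zero h⁻¹).symm⟩
  add_mem' {x y} hx hy := ⟨add_mem hx.1 hy.1, fun g h hh => by
    rw [Pi.add_apply, Pi.add_apply, hx.2 g h hh, hy.2 g h hh, Ad_add]⟩
  smul_mem' c x hx := ⟨Submodule.smul_mem _ c hx.1, fun g h hh => by
    rw [Pi.smul_apply, Pi.smul_apply, hx.2 g h hh, Ad_smul]⟩

theorem Ad_one (v : GroupLieAlgebra I G) : Ad (1 : G) v = v := by
  have h : (fun a : G => 1 * a * (1 : G)⁻¹) = id := by ext a; simp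
  unfold Ad
  rw [h, mfderiv_id]
  rfl

theorem Ad_mul [LieGroup I ∞ G] (g h : G) (v : GroupLieAlgebra I G) :
    Ad (g * h) v = Ad g (Ad h v) := by
  have hd : ∀ k : G, MDifferentiable I I (fun a : G => k * a * k⁻¹) := fun k =>
    ((contMDiff_mul_right (I := I) (n := ∞) (a := k⁻¹)).comp
      (contMDiff_mul_left (I := I) (n := ∞) (a := k))).mdifferentiable (by simp)
  have hc : (fun a : G => (g * h) * a * (g * h)⁻¹)
      = (fun a : G => g * a * g⁻¹) ∘ (fun a : G => h * a * h⁻¹) := by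
    ext a; simp [mul_assoc]
  have h1 : ∀ (p : G) (w : E), p = 1 →
      (mfderiv I I (fun a : G => g * a * g⁻¹) p : E →L[ℝ] E) w
        = (mfderiv I I (fun a : G => g * a * g⁻¹) 1 : E →L[ℝ] E) w := by
    rintro p w rfl; rfl
  have h2 : mfderiv I I (fun a : G => (g * h) * a * (g * h)⁻¹) 1
      = (mfderiv I I ((fun a : G => g * a * g⁻¹) ∘ (fun a : G => h * a * h⁻¹)) 1 : E →L[ℝ] E) := by
    rw [hc]
  have h3 : (mfderiv I I ((fun a : G => g * a * g⁻¹) ∘ (fun a : G => h * a * h⁻¹)) 1 :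
      E →L[ℝ] E) = (mfderiv I I (fun a : G => g * a * g⁻¹) (h * 1 * h⁻¹) : E →L[ℝ] E).comp
        (mfderiv I I (fun a : G => h * a * h⁻¹) 1 : E →L[ℝ] E) :=
    mfderiv_comp (I' := I) (1 : G) (hd g _) (hd h _)
  have h4 := congrArg (fun L : E →L[ℝ] E => L v) (h2.trans h3)
  exact h4.trans (h1 _ _ (by simp))

/-! ### The Atiyah bundle of a homogeneous space -/

variable {M : Type*} [MulAction G M] [LieGroup I ∞ G]

variable (I) in
/-- The relation `(g, v) ∼ (g h, Ad_{h⁻¹} v)` for `h` in the isotropy subgroup of `o`. -/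
def atiyahSetoid (o : M) : Setoid (G × GroupLieAlgebra I G) where
  r p q := ∃ h ∈ MulAction.stabilizer G o, q = (p.1 * h, Ad h⁻¹ p.2)
  iseqv :=
    { refl := fun p => ⟨1, one_mem _, by rw [inv_one, Ad_one, mul_one]⟩
      symm := by
        rintro p q ⟨h, hh, rfl⟩
        refine ⟨h⁻¹, inv_mem hh, ?_⟩
        rw [← Ad_mul]
        simp [Ad_one]
      trans := by
        rintro p q r ⟨h, hh, rfl⟩ ⟨k, hk, rfl⟩
        refine ⟨h * k, mul_mem hh hk, ?_⟩
        rw [← Ad_mul, mul_inv_rev, mul_assoc] }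

variable (I) in
/-- The total space `G ×_H 𝔤` of the Atiyah bundle, `H` being the isotropy subgroup of `o`. -/
def AtiyahBundle (o : M) : Type _ := Quotient (atiyahSetoid (G := G) I o)

/-- The class of `(g, v)` in `G ×_H 𝔤`. -/
def AtiyahBundle.mk (o : M) (g : G) (v : GroupLieAlgebra I G) : AtiyahBundle (G := G) I o :=
  Quotient.mk (atiyahSetoid I o) (g, v)

theorem AtiyahBundle.mk_eq_iff {o : M} {g g' : G} {v v' : GroupLieAlgebra I G} :
    AtiyahBundle.mk o g v = AtiyahBundle.mk o g' v' ↔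
      ∃ h ∈ MulAction.stabilizer G o, g' = g * h ∧ v' = Ad h⁻¹ v := by
  refine Quotient.eq.trans ?_
  exact exists_congr fun h => and_congr_right fun _ => Prod.mk_inj

/-- The projection `G ×_H 𝔤 → M`, `(g, v) ↦ g • o`. -/
def AtiyahBundle.proj (o : M) : AtiyahBundle (G := G) I o → M :=
  Quotient.lift (fun p => p.1 • o) (by
    rintro p q ⟨h, hh, rfl⟩
    rw [mul_smul, MulAction.mem_stabilizer_iff.mp hh])

variable (I G) in
/-- The fibre of `G ×_H 𝔤` over `u`. -/
def AtiyahFiber (o u : M) : Type _ := {q : AtiyahBundle (G := G) I o // q.proj o = u}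

/-- The class of `(g, v)` as a point of the fibre over `u = g • o`. -/
def AtiyahFiber.mk {o u : M} (g : G) (hg : g • o = u) (v : GroupLieAlgebra I G) :
    AtiyahFiber I G o u :=
  ⟨AtiyahBundle.mk o g v, hg⟩

/-- If `g • o = u`, then `v ↦ [(g, v)]` is a bijection from the Lie algebra to the fibre. -/
theorem AtiyahFiber.mk_bijective {o u : M} (g : G) (hg : g • o = u) :
    Function.Bijective (AtiyahFiber.mk (I := I) g hg) := by
  constructor
  · intro v w hvw
    obtain ⟨h, -, h1, h2⟩ := AtiyahBundle.mk_eq_iff.mp (congrArg (fun q : AtiyahFiber I G o u => q.1) hvw)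
    have h3 : h = 1 := by simpa using h1
    rw [h2, h3, inv_one, Ad_one]
  · rintro ⟨q, hq⟩
    induction q using Quotient.inductionOn with
    | h p =>
      obtain ⟨k, w⟩ := p
      have hk : k • o = u := hq
      refine ⟨Ad (g⁻¹ * k) w, Subtype.ext ?_⟩
      refine AtiyahBundle.mk_eq_iff.mpr ⟨g⁻¹ * k, ?_, by group, ?_⟩
      · rw [MulAction.mem_stabilizer_iff, mul_smul, hk, ← hg, inv_smul_smul]
      · rw [← Ad_mul, inv_mul_cancel, Ad_one]

section Fiber

variable [MulAction.IsPretransitive G M]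

/-- An identification of the fibre over `u` with the Lie algebra, by a choice of `g` with
`g • o = u`. It serves to define the vector space structure of the fibre, which does not depend on
the choice: see `AtiyahFiber.mk_add` and `AtiyahFiber.mk_smul`. -/
def fiberEquiv (o u : M) : AtiyahFiber I G o u ≃ GroupLieAlgebra I G :=
  (Equiv.ofBijective _ (AtiyahFiber.mk_bijective (I := I)
    (MulAction.exists_smul_eq G o u).choose (MulAction.exists_smul_eq G o u).choose_spec)).symm

instance (o u : M) : AddCommGroup (AtiyahFiber I G o u) := (fiberEquiv o u).addCommGroup

instance (o u : M) : Module ℝ (AtiyahFiber I G o u) := (fiberEquiv o u).module ℝ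

theorem fiberEquiv_mk {o u : M} (g : G) (hg : g • o = u) (v : GroupLieAlgebra I G) :
    fiberEquiv o u (AtiyahFiber.mk g hg v)
      = Ad ((MulAction.exists_smul_eq G o u).choose⁻¹ * g) v := by
  have hk : (MulAction.exists_smul_eq G o u).choose • o = u :=
    (MulAction.exists_smul_eq G o u).choose_spec
  rw [← Equiv.eq_symm_apply]
  refine Subtype.ext (Eq.symm ?_)
  refine AtiyahBundle.mk_eq_iff.mpr
    ⟨(MulAction.exists_smul_eq G o u).choose⁻¹ * g, ?_, by group, ?_⟩
  · rw [MulAction.mem_stabilizer_iff, mul_smul, hg, inv_smul_eq_iff, hk]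
  · rw [← Ad_mul, inv_mul_cancel, Ad_one]

theorem AtiyahFiber.mk_add {o u : M} (g : G) (hg : g • o = u) (v w : GroupLieAlgebra I G) :
    AtiyahFiber.mk g hg (v + w) = AtiyahFiber.mk g hg v + AtiyahFiber.mk g hg w := by
  apply (fiberEquiv o u).injective
  rw [Equiv.add_def, Equiv.apply_symm_apply, fiberEquiv_mk, fiberEquiv_mk, fiberEquiv_mk, Ad_add]

theorem AtiyahFiber.mk_smul {o u : M} (g : G) (hg : g • o = u) (c : ℝ)
    (v : GroupLieAlgebra I G) :
    AtiyahFiber.mk g hg (c • v) = c • AtiyahFiber.mk g hg v := by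
  apply (fiberEquiv o u).injective
  rw [Equiv.smul_def, Equiv.apply_symm_apply, fiberEquiv_mk, fiberEquiv_mk, Ad_smul]

theorem AtiyahFiber.mk_zero {o u : M} (g : G) (hg : g • o = u) :
    AtiyahFiber.mk g hg (0 : GroupLieAlgebra I G) = 0 := by
  have h := AtiyahFiber.mk_smul (I := I) g hg 0 0
  rwa [zero_smul, zero_smul] at h

end Fiber

variable {E' : Type*} [NormedAddCommGroup E'] [NormedSpace ℝ E']
  {B' : Type*} [TopologicalSpace B'] {I' : ModelWithCorners ℝ E' B'}
  [TopologicalSpace M] [ChartedSpace B' M]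

variable (I I') in
/-- A Cartan gauge `(σ, U)`: a smooth local section over the open set `U` of the principal
`H`-bundle `G → M`, `g ↦ g • o`. -/
structure IsCartanGauge (o : M) (U : Set M) (σ : M → G) : Prop where
  isOpen : IsOpen U
  smooth : ContMDiffOn I' I ∞ σ U
  smul_eq : ∀ u ∈ U, σ u • o = u

variable (I') in
/-- A section `X` of `G ×_H 𝔤` is smooth if it is smooth in each local trivialization
`(u, v) ↦ [(σ u, v)]` of the bundle, that is, for each Cartan gauge `(σ, U)` it has the form
`X u = [(σ u, f u)]` on `U` with a smooth function `f` on `U`. -/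
def IsSmoothSection {o : M} (X : (u : M) → AtiyahFiber I G o u) : Prop :=
  ∀ (U : Set M) (σ : M → G), IsCartanGauge I I' o U σ →
    ∃ f : M → GroupLieAlgebra I G, ContMDiffOn I' 𝓘(ℝ, E) ∞ (M' := E) f U ∧
      ∀ (u : M) (hu : σ u • o = u), u ∈ U → X u = AtiyahFiber.mk (σ u) hu (f u)

variable (I I' G) in
/-- The space of smooth sections of `G ×_H 𝔤`, with its pointwise vector space structure. -/
def smoothSections [MulAction.IsPretransitive G M] (o : M) :
    Submodule ℝ ((u : M) → AtiyahFiber I G o u) where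
  carrier := {X | IsSmoothSection I' X}
  zero_mem' := fun _ σ _ => ⟨fun _ => 0, contMDiffOn_const (c := (0 : E)),
    fun u hu _ => (AtiyahFiber.mk_zero (σ u) hu).symm⟩
  add_mem' {X Y} hX hY := fun U σ hσ => by
    obtain ⟨f, hf, hfX⟩ := hX U σ hσ
    obtain ⟨k, hk, hkY⟩ := hY U σ hσ
    refine ⟨fun u => f u + k u, ContMDiffOn.add (G := E) (f := f) (g := k) hf hk,
      fun u hu hU => ?_⟩
    rw [Pi.add_apply, hfX u hu hU, hkY u hu hU, AtiyahFiber.mk_add]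
  smul_mem' c X hX := fun U σ hσ => by
    obtain ⟨f, hf, hfX⟩ := hX U σ hσ
    refine ⟨fun u => c • f u, (contDiff_const_smul (𝕜 := ℝ) (F := E) (n := ∞) c).contMDiff.comp_contMDiffOn
      (I' := 𝓘(ℝ, E)) hf,
      fun u hu hU => ?_⟩
    rw [Pi.smul_apply, hfX u hu hU, AtiyahFiber.mk_smul]

end AtiyahPostLie

end

/-!
Left translation trivializes the tangent bundle of `G`, so that `(x ▷ y)(g) = Dy(g)(x(g))`, where
`Dy : G → Hom(𝔤, 𝔤)` is the left derivative of `y`. By the product rule the associator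
`a(x, y, z)` is the second left derivative `D²z` evaluated at `x` and `y`. Iterated derivatives
along left-invariant vector fields commute up to the derivative along their Lie bracket, so
`a(x, y, z) - a(y, x, z)` is the derivative of `z` along `[x, y]`. Equivariance passes to `x ▷ y`
because `g h a = g (h a h⁻¹) h`.

A section `X` of the Atiyah bundle determines a unique function `x` with `X(g o) = [(g, x(g))]`, and
`x` is equivariant; its smoothness is seen in Cartan gauges, so these must be shown to exist. By
homogeneity the orbit map `g ↦ g o` has constant rank, and a map of constant rank from a second
countable manifold onto `M` is a submersion, hence has smooth local sections.
-/

/-! ### Maps of constant rank -/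

section ConstantRank

open Module Topology Metric

theorem ker_comp_eq_ker_of_surjective_of_finrank_range_le {k V W R : Type*} [Field k]
    [AddCommGroup V] [Module k V] [AddCommGroup W] [Module k W] [AddCommGroup R] [Module k R]
    {f : V →ₗ[k] W} {p : W →ₗ[k] R} [FiniteDimensional k f.range]
    (hp : Function.Surjective (p ∘ₗ f)) (hf : finrank k f.range ≤ finrank k R) :
    (p ∘ₗ f).ker = f.ker := by
  let q : f.range →ₗ[k] R := p ∘ₗ f.range.subtype
  have hqf : q ∘ₗ f.rangeRestrict = p ∘ₗ f := rfl
  have hq : Function.Surjective q := .of_comp (g := f.rangeRestrict) hp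
  have : FiniteDimensional k R := .of_surjective q hq
  have hq' : Function.Injective q :=
    (LinearMap.injective_iff_surjective_of_finrank_eq_finrank
      (hf.antisymm (LinearMap.finrank_le_finrank_of_surjective hq))).2 hq
  rw [← hqf, LinearMap.ker_comp_of_ker_eq_bot _ (LinearMap.ker_eq_bot.2 hq'),
    LinearMap.ker_rangeRestrict]

theorem finrank_range_comp_comp_of_injective_of_surjective {k V₁ V₂ V₃ V₄ : Type*} [Field k]
    [AddCommGroup V₁] [Module k V₁] [AddCommGroup V₂] [Module k V₂]
    [AddCommGroup V₃] [Module k V₃] [AddCommGroup V₄] [Module k V₄]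
    {a : V₃ →ₗ[k] V₄} (f : V₂ →ₗ[k] V₃) {c : V₁ →ₗ[k] V₂}
    (ha : Function.Injective a) (hc : Function.Surjective c) :
    finrank k (a ∘ₗ f ∘ₗ c).range = finrank k f.range := by
  rw [LinearMap.range_comp, LinearMap.range_comp_of_range_eq_top f (LinearMap.range_eq_top.2 hc)]
  exact (Submodule.equivMapOfInjective a ha _).finrank_eq.symm

theorem exists_openPartialHomeomorph_fst_eq {𝕜 E F : Type*} [RCLike 𝕜]
    [NormedAddCommGroup E] [NormedSpace 𝕜 E] [CompleteSpace E]
    [NormedAddCommGroup F] [NormedSpace 𝕜 F] [FiniteDimensional 𝕜 F]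
    {f : E → F} {s : Set E} {x : E} {n : ℕ∞ω} (hn : n ≠ 0) (hs : IsOpen s)
    (hf : ContDiffOn 𝕜 n f s) (hx : x ∈ s) (hfx : Function.Surjective (fderiv 𝕜 f x)) :
    ∃ e : OpenPartialHomeomorph E (F × (fderiv 𝕜 f x).ker), x ∈ e.source ∧ e.source ⊆ s ∧
      (∀ y, (e y).1 = f y) ∧ ContDiffOn 𝕜 n e.symm e.target := by
  have := FiniteDimensional.complete 𝕜 F
  obtain ⟨q, hq⟩ := (fderiv 𝕜 f x).ker_closedComplemented_of_finiteDimensional_range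
  let φ : E → F × (fderiv 𝕜 f x).ker := fun y => (f y, q y)
  have hφ : ∀ y ∈ s, ContDiffAt 𝕜 n φ y := fun y hy =>
    (hf.contDiffAt (hs.mem_nhds hy)).prodMk q.contDiff.contDiffAt
  have hqr : q.range = ⊤ := LinearMap.range_eq_top.2 fun v => ⟨v, hq v⟩
  have hqk : IsCompl (fderiv 𝕜 f x).ker q.ker := LinearMap.isCompl_of_proj hq
  let L := (fderiv 𝕜 f x).equivProdOfSurjectiveOfIsCompl q (LinearMap.range_eq_top.2 hfx) hqr hqk
  have hL : HasFDerivAt φ (L : E →L[𝕜] F × (fderiv 𝕜 f x).ker) x :=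
    ((hf.contDiffAt (hs.mem_nhds hx)).differentiableAt hn).hasFDerivAt.prodMk q.hasFDerivAt
  let e := (hφ x hx).toOpenPartialHomeomorph φ hL hn
  let t : Set E := s ∩ fderiv 𝕜 φ ⁻¹' Set.range
    fun T : E ≃L[𝕜] F × (fderiv 𝕜 f x).ker => (T : E →L[𝕜] F × (fderiv 𝕜 f x).ker)
  have ht : IsOpen t := ContinuousOn.isOpen_inter_preimage
    (fun y hy => ((hφ y hy).continuousAt_fderiv hn).continuousWithinAt) hs
    ContinuousLinearEquiv.isOpen
  refine ⟨e.restrOpen t ht, ⟨(hφ x hx).mem_toOpenPartialHomeomorph_source hL hn, hx, L,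
    hL.fderiv.symm⟩, fun y hy => hy.2.1, fun y => rfl, fun w hw => ?_⟩
  obtain ⟨-, hws, L', hL'⟩ := (e.restrOpen t ht).map_target hw
  have hφw : HasFDerivAt φ (L' : E →L[𝕜] F × (fderiv 𝕜 f x).ker) ((e.restrOpen t ht).symm w) :=
    ((hφ _ hws).differentiableAt hn).hasFDerivAt.congr_fderiv hL'.symm
  exact ((e.restrOpen t ht).contDiffAt_symm hw hφw (hφ _ hws)).contDiffWithinAt

theorem exists_contDiffOn_rightInverse {𝕜 E F : Type*} [RCLike 𝕜]
    [NormedAddCommGroup E] [NormedSpace 𝕜 E] [CompleteSpace E]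
    [NormedAddCommGroup F] [NormedSpace 𝕜 F] [FiniteDimensional 𝕜 F]
    {f : E → F} {s : Set E} {x : E} {n : ℕ∞ω} (hn : n ≠ 0) (hs : IsOpen s)
    (hf : ContDiffOn 𝕜 n f s) (hx : x ∈ s) (hfx : Function.Surjective (fderiv 𝕜 f x)) :
    ∃ (t : Set F) (σ : F → E), IsOpen t ∧ f x ∈ t ∧ ContDiffOn 𝕜 n σ t ∧ Set.MapsTo σ t s ∧
      Set.RightInvOn σ f t := by
  obtain ⟨e, hxe, hes, hef, he⟩ := exists_openPartialHomeomorph_fst_eq hn hs hf hx hfx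
  have hι : ContDiff 𝕜 n fun w : F => (w, (e x).2) := contDiff_id.prodMk contDiff_const
  refine ⟨(fun w => (w, (e x).2)) ⁻¹' e.target, fun w => e.symm (w, (e x).2),
    e.open_target.preimage hι.continuous, ?_, he.comp hι.contDiffOn fun w hw => hw,
    fun w hw => hes (e.map_target hw), fun w hw => ?_⟩
  · rw [Set.mem_preimage, ← hef]
    exact e.map_source hxe
  · rw [← hef, e.right_inv hw]

variable {E F R : Type*} [NormedAddCommGroup E] [NormedSpace ℝ E]
  [NormedAddCommGroup F] [NormedSpace ℝ F] [NormedAddCommGroup R] [NormedSpace ℝ R]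

theorem apply_prodMk_eq_of_fderiv_apply_snd_eq_zero {s : Set E} {t : Set F} (hs : IsOpen s)
    (ht : IsOpen t) (ht' : Convex ℝ t) {f : E × F → R} (hf : DifferentiableOn ℝ f (s ×ˢ t))
    (h : ∀ p ∈ s ×ˢ t, ∀ b : F, fderiv ℝ f p (0, b) = 0) {a : E} (ha : a ∈ s) {b c : F}
    (hb : b ∈ t) (hc : c ∈ t) : f (a, b) = f (a, c) := by
  have hderiv : ∀ y ∈ t, HasFDerivAt (fun y => f (a, y)) (0 : F →L[ℝ] R) y := fun y hy => by
    have hfy := (hf.differentiableAt ((hs.prod ht).mem_nhds ⟨ha, hy⟩)).hasFDerivAt.comp y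
      (hasFDerivAt_prodMk_right a y)
    have hzero : fderiv ℝ f (a, y) ∘L .inr ℝ E F = 0 := by
      ext b
      exact h (a, y) ⟨ha, hy⟩ b
    rwa [hzero] at hfy
  exact ht.is_const_of_fderiv_eq_zero ht'.isPreconnected
    (fun y hy => (hderiv y hy).differentiableAt.differentiableWithinAt)
    (fun y hy => (hderiv y hy).fderiv) hb hc

/-- Straighten `g` to a projection: then `f` depends only on the first coordinate. -/
theorem exists_eventuallyEq_comp_of_ker_fderiv_le [CompleteSpace E] [FiniteDimensional ℝ R]
    {f : E → F} {g : E → R} {s : Set E} {x : E} (hs : IsOpen s) (hx : x ∈ s)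
    (hf : ContDiffOn ℝ 1 f s) (hg : ContDiffOn ℝ 1 g s)
    (hgx : Function.Surjective (fderiv ℝ g x))
    (hker : ∀ y ∈ s, (fderiv ℝ g y).ker ≤ (fderiv ℝ f y).ker) :
    ∃ (h : R → F) (ε : ℝ), 0 < ε ∧ ContDiffOn ℝ 1 h (ball (g x) ε) ∧
      ∀ᶠ y in 𝓝 x, f y = h (g y) := by
  obtain ⟨e, hxe, hes, heg, he⟩ := exists_openPartialHomeomorph_fst_eq one_ne_zero hs hg hx hgx
  have hfe : ContDiffOn ℝ 1 (f ∘ e.symm) e.target := hf.comp he fun p hp => hes (e.map_target hp)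
  obtain ⟨ε, hε, hball⟩ := Metric.isOpen_iff.1 e.open_target (e x) (e.map_source hxe)
  rw [← ball_prod_same, heg] at hball
  have hzero : ∀ p ∈ e.target, ∀ b, fderiv ℝ (f ∘ e.symm) p (0, b) = 0 := fun p hp b => by
    have hps := hs.mem_nhds (hes (e.map_target hp))
    have hep := (he.contDiffAt (e.open_target.mem_nhds hp)).differentiableAt one_ne_zero
    have hge : fderiv ℝ (g ∘ e.symm) p = .fst ℝ _ _ := by
      refine (hasFDerivAt_fst.congr_of_eventuallyEq ?_).fderiv
      filter_upwards [e.open_target.mem_nhds hp] with z hz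
      rw [Function.comp_apply, ← heg, e.right_inv hz]
    rw [fderiv_comp p ((hg.contDiffAt hps).differentiableAt one_ne_zero) hep] at hge
    rw [fderiv_comp p ((hf.contDiffAt hps).differentiableAt one_ne_zero) hep]
    exact hker _ (hes (e.map_target hp)) (DFunLike.congr_fun hge (0, b))
  refine ⟨fun a => f (e.symm (a, (e x).2)), ε, hε, ?_, ?_⟩
  · exact hfe.comp (f := fun a => (a, (e x).2)) (contDiff_id.prodMk contDiff_const).contDiffOn
      fun a ha => hball ⟨ha, mem_ball_self hε⟩
  · filter_upwards [e.open_source.mem_nhds hxe,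
      (e.continuousAt hxe).preimage_mem_nhds (ball_mem_nhds (e x) hε)] with y hy hye
    rw [Set.mem_preimage, ← ball_prod_same, heg] at hye
    rw [← heg]
    refine (congrArg f (e.left_inv hy).symm).trans ?_
    refine apply_prodMk_eq_of_fderiv_apply_snd_eq_zero (f := f ∘ e.symm) (b := (e y).2)
      isOpen_ball isOpen_ball (convex_ball (e x).2 ε)
      ((hfe.differentiableOn one_ne_zero).mono hball) (fun p hp => hzero p (hball hp)) ?_ hye.2
      (mem_ball_self hε)
    exact hye.1

theorem isOpen_setOf_surjective {𝕜 E F : Type*} [NontriviallyNormedField 𝕜] [CompleteSpace 𝕜]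
    [NormedAddCommGroup E] [NormedSpace 𝕜 E] [NormedAddCommGroup F] [NormedSpace 𝕜 F]
    [FiniteDimensional 𝕜 F] : IsOpen {L : E →L[𝕜] F | Function.Surjective L} := by
  convert! isOpen_setOfPred_nat_le_rank (𝕜 := 𝕜) (E := E) (F := F) (finrank 𝕜 F) using 3 with L
  have hL : LinearMap.rank (L : E →ₗ[𝕜] F) = finrank 𝕜 (L : E →ₗ[𝕜] F).range :=
    (finrank_eq_rank 𝕜 _).symm
  rw [hL, Nat.cast_le]
  exact LinearMap.range_eq_top.symm.trans ⟨fun h => by rw [h, finrank_top],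
    fun h => Submodule.eq_top_of_finrank_eq (h.antisymm' (Submodule.finrank_le _))⟩

/-- Composing with a projection onto the range of the derivative at `x` yields a submersion whose
derivatives have the same kernels, so that the map factors through it near `x`. -/
theorem exists_dimH_image_le_of_finrank_range_fderiv_le [CompleteSpace E] [FiniteDimensional ℝ F]
    {f : E → F} {s : Set E} {x : E} (hs : IsOpen s) (hx : x ∈ s) (hf : ContDiffOn ℝ 1 f s)
    (hr : ∀ y ∈ s, finrank ℝ (fderiv ℝ f y).range ≤ finrank ℝ (fderiv ℝ f x).range) :
    ∃ V ∈ 𝓝 x, dimH (f '' V) ≤ finrank ℝ (fderiv ℝ f x).range := by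
  obtain ⟨p, hp⟩ := Submodule.ClosedComplemented.of_finiteDimensional (fderiv ℝ f x).range
  let t := s ∩ fderiv ℝ f ⁻¹' {L | Function.Surjective (p ∘L L)}
  have ht : IsOpen t := (hf.continuousOn_fderiv_of_isOpen hs le_rfl).isOpen_inter_preimage hs
    (isOpen_setOf_surjective.preimage (continuous_const.clm_comp continuous_id))
  have hxt : x ∈ t := ⟨hx, fun v => by
    obtain ⟨w, hw⟩ := v.2
    exact ⟨w, (congrArg p hw).trans (hp v)⟩⟩
  have hpf : ∀ y ∈ s, fderiv ℝ (p ∘ f) y = p ∘L fderiv ℝ f y := fun y hy =>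
    (p.hasFDerivAt.comp y
      ((hf.contDiffAt (hs.mem_nhds hy)).differentiableAt one_ne_zero).hasFDerivAt).fderiv
  obtain ⟨h, ε, hε, hh, hfh⟩ := exists_eventuallyEq_comp_of_ker_fderiv_le (f := f) (g := p ∘ f) ht
    hxt (hf.mono Set.inter_subset_left)
    (p.contDiff.comp_contDiffOn (hf.mono Set.inter_subset_left))
    (by rw [hpf x hx]; exact hxt.2) (fun y hy => by
      rw [hpf y hy.1]
      exact (ker_comp_eq_ker_of_surjective_of_finrank_range_le hy.2 (hr y hy.1)).le)
  have hfx : ContinuousAt (p ∘ f) x :=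
    p.continuous.continuousAt.comp (hf.contDiffAt (hs.mem_nhds hx)).continuousAt
  refine ⟨_, Filter.inter_mem hfh (hfx.preimage_mem_nhds (ball_mem_nhds _ hε)), ?_⟩
  calc dimH (f '' _) ≤ dimH (h '' ball ((p ∘ f) x) ε) := dimH_mono ?_
    _ ≤ dimH (ball ((p ∘ f) x) ε) := hh.dimH_image_le (convex_ball _ _) subset_rfl
    _ ≤ _ := (dimH_mono (Set.subset_univ _)).trans (Real.dimH_univ_eq_finrank _).le
  rintro _ ⟨y, ⟨hy, hyε⟩, rfl⟩
  exact ⟨p (f y), hyε, hy.symm⟩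

end ConstantRank

/-! ### Derivatives of maps between manifolds -/

section Manifold

open Module Topology

variable {𝕜 : Type*} [NontriviallyNormedField 𝕜]
  {E : Type*} [NormedAddCommGroup E] [NormedSpace 𝕜 E]
  {B : Type*} [TopologicalSpace B] {I : ModelWithCorners 𝕜 E B}
  {N : Type*} [TopologicalSpace N] [ChartedSpace B N]
  {E' : Type*} [NormedAddCommGroup E'] [NormedSpace 𝕜 E']
  {B' : Type*} [TopologicalSpace B'] {I' : ModelWithCorners 𝕜 E' B'}
  {M : Type*} [TopologicalSpace M] [ChartedSpace B' M]
  {E'' : Type*} [NormedAddCommGroup E''] [NormedSpace 𝕜 E'']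
  {B'' : Type*} [TopologicalSpace B''] {I'' : ModelWithCorners 𝕜 E'' B''}
  {M' : Type*} [TopologicalSpace M'] [ChartedSpace B'' M']

variable (I I') in
/-- The manifold derivative `mfderiv`, with the tangent spaces replaced by the model spaces which
they are by definition. Derivatives at points that are only provably equal then have the same type,
and can be composed. -/
noncomputable def modelDeriv (f : N → M) (x : N) : E →L[𝕜] E' := mfderiv I I' f x

theorem modelDeriv_eq_fderiv (f : E → E') (x : E) :
    modelDeriv 𝓘(𝕜, E) 𝓘(𝕜, E') f x = fderiv 𝕜 f x :=
  mfderiv_eq_fderiv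

theorem modelDeriv_comp_of_eq {g : M → M'} {f : N → M} {x : N} {y : M}
    (hg : MDifferentiableAt I' I'' g y) (hf : MDifferentiableAt I I' f x) (hy : f x = y) :
    modelDeriv I I'' (g ∘ f) x = modelDeriv I' I'' g y ∘L modelDeriv I I' f x := by
  subst hy
  exact mfderiv_comp x hg hf

theorem modelDeriv_congr {f g : N → M} {x : N} (h : f =ᶠ[𝓝 x] g) :
    modelDeriv I I' f x = modelDeriv I I' g x := by
  ext v
  exact DFunLike.congr_fun h.mfderiv_eq v

theorem modelDeriv_comp_of_leftInverse {g : M → N} {f : N → M} {x : N} {y : M}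
    (hg : MDifferentiableAt I' I g y) (hf : MDifferentiableAt I I' f x) (hy : f x = y)
    (h : Function.LeftInverse g f) :
    modelDeriv I' I g y ∘L modelDeriv I I' f x = .id 𝕜 E := by
  rw [← modelDeriv_comp_of_eq hg hf hy, h.comp_eq_id]
  exact mfderiv_id

variable (I I') in
/-- The expression of `f` in the chart at `p` of the source and the chart at `q` of the target. -/
def chartExpr (p : N) (q : M) (f : N → M) : E → E' :=
  extChartAt I' q ∘ f ∘ (extChartAt I p).symm

variable (I I') in
/-- The set of points at which `chartExpr I I' p q f` represents `f`. -/
def chartDomain (p : N) (q : M) (f : N → M) : Set E :=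
  (extChartAt I p).target ∩ (extChartAt I p).symm ⁻¹' (f ⁻¹' (extChartAt I' q).source)

theorem extChartAt_mem_chartDomain {p : N} {q : M} {f : N → M}
    (hp : f p ∈ (extChartAt I' q).source) : extChartAt I p p ∈ chartDomain I I' p q f :=
  ⟨mem_extChartAt_target p, by rwa [Set.mem_preimage, Set.mem_preimage, extChartAt_to_inv]⟩

variable [I.Boundaryless]

theorem isOpen_chartDomain {f : N → M} (hf : Continuous f) (p : N) (q : M) :
    IsOpen (chartDomain I I' p q f) :=
  (continuousOn_extChartAt_symm p).isOpen_inter_preimage (isOpen_extChartAt_target p)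
    ((isOpen_extChartAt_source q).preimage hf)

theorem contMDiffAt_extChartAt_symm {n : ℕ∞ω} [IsManifold I n N] {p : N} {y : E}
    (hy : y ∈ (extChartAt I p).target) : ContMDiffAt 𝓘(𝕜, E) I n (extChartAt I p).symm y :=
  (contMDiffOn_extChartAt_symm p).contMDiffAt ((isOpen_extChartAt_target p).mem_nhds hy)

theorem contDiffOn_chartExpr {n : ℕ∞ω} [IsManifold I n N] [IsManifold I' n M] {f : N → M}
    (hf : ContMDiff I I' n f) (p : N) (q : M) :
    ContDiffOn 𝕜 n (chartExpr I I' p q f) (chartDomain I I' p q f) := fun y hy =>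
  ((contMDiffAt_extChartAt' (extChartAt_source I' q ▸ hy.2)).comp y
    (hf.contMDiffAt.comp y (contMDiffAt_extChartAt_symm hy.1))).contDiffAt.contDiffWithinAt

variable [IsManifold I 1 N] [IsManifold I' 1 M]

theorem exists_bijective_fderiv_chartExpr_eq {f : N → M} {p : N} {q : M} {y : E}
    (hy : y ∈ chartDomain I I' p q f)
    (hf : MDifferentiableAt I I' f ((extChartAt I p).symm y)) :
    ∃ (A : E' →L[𝕜] E') (C : E →L[𝕜] E), Function.Bijective A ∧ Function.Bijective C ∧
      fderiv 𝕜 (chartExpr I I' p q f) y =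
        A ∘L modelDeriv I I' f ((extChartAt I p).symm y) ∘L C := by
  obtain ⟨A, hA⟩ := isInvertible_mfderiv_extChartAt (I := I') hy.2
  obtain ⟨C, hC⟩ := isInvertible_mfderivWithin_extChartAt_symm (I := I) hy.1
  rw [I.range_eq_univ, mfderivWithin_univ] at hC
  have hsymm := (contMDiffAt_extChartAt_symm (I := I) (n := 1) hy.1).mdifferentiableAt one_ne_zero
  have hchart : MDifferentiableAt I' 𝓘(𝕜, E') (extChartAt I' q) (f ((extChartAt I p).symm y)) :=
    mdifferentiableAt_extChartAt (extChartAt_source I' q ▸ hy.2)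
  refine ⟨modelDeriv I' 𝓘(𝕜, E') (extChartAt I' q) (f ((extChartAt I p).symm y)),
    modelDeriv 𝓘(𝕜, E) I (extChartAt I p).symm y, ?_, ?_, ?_⟩
  · exact (congrArg (fun L : E' →L[𝕜] E' => Function.Bijective L) hA).mp A.bijective
  · exact (congrArg (fun L : E →L[𝕜] E => Function.Bijective L) hC).mp C.bijective
  · rw [← modelDeriv_eq_fderiv, ← modelDeriv_comp_of_eq hf hsymm rfl]
    exact modelDeriv_comp_of_eq hchart (hf.comp y hsymm) rfl

theorem surjective_fderiv_chartExpr {f : N → M} {p : N} {q : M}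
    (hq : f p ∈ (extChartAt I' q).source) (hf : MDifferentiableAt I I' f p)
    (h : Function.Surjective (modelDeriv I I' f p)) :
    Function.Surjective (fderiv 𝕜 (chartExpr I I' p q f) (extChartAt I p p)) := by
  rw [← extChartAt_to_inv (I := I) p] at hf h
  obtain ⟨A, C, hA, hC, hAC⟩ :=
    exists_bijective_fderiv_chartExpr_eq (extChartAt_mem_chartDomain hq) hf
  rw [hAC]
  exact hA.2.comp (h.comp hC.2)

theorem finrank_range_fderiv_chartExpr {f : N → M} {p : N} {q : M} {y : E}
    (hy : y ∈ chartDomain I I' p q f)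
    (hf : MDifferentiableAt I I' f ((extChartAt I p).symm y)) :
    finrank 𝕜 (fderiv 𝕜 (chartExpr I I' p q f) y).range =
      finrank 𝕜 (modelDeriv I I' f ((extChartAt I p).symm y)).range := by
  obtain ⟨A, C, hA, hC, hAC⟩ := exists_bijective_fderiv_chartExpr_eq hy hf
  rw [hAC]
  exact finrank_range_comp_comp_of_injective_of_surjective _ hA.1 hC.2

end Manifold

section Submersion

open Module Topology

theorem exists_contMDiffOn_rightInverse {𝕜 : Type*} [RCLike 𝕜]
    {E : Type*} [NormedAddCommGroup E] [NormedSpace 𝕜 E] [CompleteSpace E]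
    {B : Type*} [TopologicalSpace B] {I : ModelWithCorners 𝕜 E B} [I.Boundaryless]
    {N : Type*} [TopologicalSpace N] [ChartedSpace B N]
    {E' : Type*} [NormedAddCommGroup E'] [NormedSpace 𝕜 E'] [FiniteDimensional 𝕜 E']
    {B' : Type*} [TopologicalSpace B'] {I' : ModelWithCorners 𝕜 E' B'}
    {M : Type*} [TopologicalSpace M] [ChartedSpace B' M]
    {n : ℕ∞ω} (hn : n ≠ 0) [IsManifold I n N] [IsManifold I' n M] {f : N → M}
    (hf : ContMDiff I I' n f) {x : N} (hx : Function.Surjective (modelDeriv I I' f x)) :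
    ∃ (U : Set M) (σ : M → N), IsOpen U ∧ f x ∈ U ∧ ContMDiffOn I' I n σ U ∧
      Set.RightInvOn σ f U := by
  have : IsManifold I 1 N := .of_le (ENat.one_le_iff_ne_zero_withTop.2 hn)
  have : IsManifold I' 1 M := .of_le (ENat.one_le_iff_ne_zero_withTop.2 hn)
  have hfx : f x ∈ (extChartAt I' (f x)).source := mem_extChartAt_source (f x)
  obtain ⟨t, σ, ht, hxt, hσ, hσS, hσf⟩ := exists_contDiffOn_rightInverse hn
    (isOpen_chartDomain hf.continuous x (f x)) (contDiffOn_chartExpr hf x (f x))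
    (extChartAt_mem_chartDomain hfx)
    (surjective_fderiv_chartExpr hfx (hf.mdifferentiable hn x) hx)
  refine ⟨(extChartAt I' (f x)).source ∩ extChartAt I' (f x) ⁻¹' t,
    (extChartAt I x).symm ∘ σ ∘ extChartAt I' (f x), isOpen_extChartAt_preimage' (f x) ht,
    ⟨hfx, ?_⟩, ?_, fun u hu => ?_⟩
  · simpa [chartExpr] using hxt
  · rintro u hu
    have hchart : ContMDiffAt I' 𝓘(𝕜, E') n (extChartAt I' (f x)) u :=
      contMDiffAt_extChartAt' (extChartAt_source I' (f x) ▸ hu.1)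
    have hσu := (hσ.contDiffAt (ht.mem_nhds hu.2)).contMDiffAt
    exact ((contMDiffAt_extChartAt_symm (hσS hu.2).1).comp u
      (hσu.comp u hchart)).contMDiffWithinAt
  · exact (extChartAt I' (f x)).injOn (hσS hu.2).2 hu.1 (hσf hu.2)

variable {E : Type*} [NormedAddCommGroup E] [NormedSpace ℝ E] [FiniteDimensional ℝ E]
  {B : Type*} [TopologicalSpace B] {I : ModelWithCorners ℝ E B} [I.Boundaryless]
  {N : Type*} [TopologicalSpace N] [ChartedSpace B N] [IsManifold I 1 N]
  {E' : Type*} [NormedAddCommGroup E'] [NormedSpace ℝ E'] [FiniteDimensional ℝ E']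
  {B' : Type*} [TopologicalSpace B'] {I' : ModelWithCorners ℝ E' B'}
  {M : Type*} [TopologicalSpace M] [ChartedSpace B' M] [IsManifold I' 1 M]

theorem exists_dimH_extChartAt_comp_image_le {f : N → M} (hf : ContMDiff I I' 1 f) {r : ℕ}
    (hr : ∀ x, finrank ℝ (modelDeriv I I' f x).range = r) {p : N} {q : M}
    (hp : f p ∈ (extChartAt I' q).source) :
    ∃ V ∈ 𝓝 p, dimH ((extChartAt I' q ∘ f) '' V) ≤ r := by
  have hrank : ∀ y ∈ chartDomain I I' p q f,
      finrank ℝ (fderiv ℝ (chartExpr I I' p q f) y).range = r := fun y hy => by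
    rw [finrank_range_fderiv_chartExpr hy (hf.mdifferentiable one_ne_zero _), hr]
  have hpc := extChartAt_mem_chartDomain (I := I) hp
  have : CompleteSpace E := FiniteDimensional.complete ℝ E
  obtain ⟨V, hV, hVd⟩ := exists_dimH_image_le_of_finrank_range_fderiv_le
    (isOpen_chartDomain hf.continuous p q) hpc (contDiffOn_chartExpr hf p q)
    fun y hy => ((hrank y hy).trans (hrank _ hpc).symm).le
  rw [hrank _ hpc] at hVd
  refine ⟨(extChartAt I p).source ∩ extChartAt I p ⁻¹' V, Filter.inter_mem
    (extChartAt_source_mem_nhds p) ((continuousAt_extChartAt p).preimage_mem_nhds hV),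
    (dimH_mono ?_).trans hVd⟩
  rintro _ ⟨z, ⟨hz, hzV⟩, rfl⟩
  exact ⟨extChartAt I p z, hzV, congrArg (extChartAt I' q ∘ f) ((extChartAt I p).left_inv hz)⟩

theorem dimH_image_le_of_forall_exists_nhds {X Y : Type*} [TopologicalSpace X]
    [SecondCountableTopology X] [EMetricSpace Y] {f : X → Y} {s : Set X} {d : ENNReal}
    (h : ∀ x ∈ s, ∃ V ∈ 𝓝 x, dimH (f '' V) ≤ d) : dimH (f '' s) ≤ d := by
  choose! V hV hVd using h
  obtain ⟨t, hts, htc, hst⟩ := TopologicalSpace.countable_cover_nhdsWithin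
    fun x hx => mem_nhdsWithin_of_mem_nhds (hV x hx)
  calc dimH (f '' s) ≤ dimH (⋃ x ∈ t, f '' V x) := by
        rw [← Set.image_iUnion₂]
        exact dimH_mono (Set.image_mono hst)
    _ = ⨆ x ∈ t, dimH (f '' V x) := dimH_bUnion htc _
    _ ≤ d := iSup₂_le fun x hx => hVd x (hts hx)

/-- By the rank theorem the image, of Hausdorff dimension `dim M`, is a countable union of sets of
dimension at most the rank. -/
theorem surjective_modelDeriv_of_surjective_of_constant_rank [SecondCountableTopology N]
    [I'.Boundaryless] {f : N → M} (hs : Function.Surjective f) (hf : ContMDiff I I' 1 f) {r : ℕ}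
    (hr : ∀ x, finrank ℝ (modelDeriv I I' f x).range = r) (x : N) :
    Function.Surjective (modelDeriv I I' f x) := by
  have htarget : (extChartAt I' (f x)).target ⊆
      (extChartAt I' (f x) ∘ f) '' (f ⁻¹' (extChartAt I' (f x)).source) := by
    rw [Set.image_comp, Set.image_preimage_eq _ hs, PartialEquiv.image_source_eq_target]
  have hdim : dimH (extChartAt I' (f x)).target ≤ r := (dimH_mono htarget).trans
    (dimH_image_le_of_forall_exists_nhds fun p hp => exists_dimH_extChartAt_comp_image_le hf hr hp)
  rw [Real.dimH_of_mem_nhds (extChartAt_target_mem_nhds (f x))] at hdim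
  refine LinearMap.range_eq_top.1
    (Submodule.eq_top_of_finrank_eq ((Submodule.finrank_le _).antisymm ?_))
  rw [hr]
  exact_mod_cast hdim

end Submersion

/-! ### Vector fields as derivations -/

section Derivation

open Topology VectorField

variable {𝕜 : Type*} [NontriviallyNormedField 𝕜]
  {E : Type*} [NormedAddCommGroup E] [NormedSpace 𝕜 E]
  {B : Type*} [TopologicalSpace B] {I : ModelWithCorners 𝕜 E B}
  {N : Type*} [TopologicalSpace N] [ChartedSpace B N]
  {F : Type*} [NormedAddCommGroup F] [NormedSpace 𝕜 F]

variable (I) in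
/-- The expression of the vector field `X` in the chart at `x`. As for `modelDeriv`, the tangent
spaces are replaced by the model space. -/
noncomputable def chartField (x : N) (X : N → E) : E → E :=
  mpullbackWithin 𝓘(𝕜, E) I (extChartAt I x).symm X (Set.range I)

theorem differentiableAt_chartField [CompleteSpace E] [I.Boundaryless] [IsManifold I 2 N] {x : N}
    {X : N → E}
    (hX : MDifferentiableAt I I.tangent (fun p => (⟨p, X p⟩ : TangentBundle I N)) x) :
    DifferentiableAt 𝕜 (chartField I x X) (extChartAt I x x) := by
  have h := (mdifferentiableWithinAt_univ.2 hX).differentiableWithinAt_mpullbackWithin_vectorField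
  rw [Set.preimage_univ, Set.univ_inter] at h
  exact h.differentiableAt (by simp [I.range_eq_univ])

section C1

variable [IsManifold I 1 N]

theorem mdifferentiableAt_extChartAt_self (x : N) :
    MDifferentiableAt I 𝓘(𝕜, E) (extChartAt I x) x :=
  mdifferentiableAt_extChartAt (mem_chart_source B x)

variable [I.Boundaryless]

theorem modelDeriv_extChartAt_symm_chartField {x : N} (X : N → E) {y : E}
    (hy : y ∈ (extChartAt I x).target) :
    modelDeriv 𝓘(𝕜, E) I (extChartAt I x).symm y (chartField I x X y) =
      X ((extChartAt I x).symm y) := by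
  have hwithin : modelDeriv 𝓘(𝕜, E) I (extChartAt I x).symm y =
      mfderivWithin 𝓘(𝕜, E) I (extChartAt I x).symm (Set.range I) y := by
    rw [I.range_eq_univ, mfderivWithin_univ]
    rfl
  rw [hwithin]
  exact (isInvertible_mfderivWithin_extChartAt_symm hy).self_apply_inverse _

theorem modelDeriv_apply_eq_fderiv_chartField {z : N → F} {x p : N}
    (hp : p ∈ (extChartAt I x).source) (hz : MDifferentiableAt I 𝓘(𝕜, F) z p)
    (X : N → E) :
    modelDeriv I 𝓘(𝕜, F) z p (X p) =
      fderiv 𝕜 (z ∘ (extChartAt I x).symm) (extChartAt I x p)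
        (chartField I x X (extChartAt I x p)) := by
  have hy := (extChartAt I x).map_source hp
  have hsymm := (contMDiffAt_extChartAt_symm (I := I) (n := 1) hy).mdifferentiableAt one_ne_zero
  rw [← modelDeriv_eq_fderiv, modelDeriv_comp_of_eq hz hsymm ((extChartAt I x).left_inv hp),
    ContinuousLinearMap.comp_apply, modelDeriv_extChartAt_symm_chartField X hy,
    (extChartAt I x).left_inv hp]

theorem modelDeriv_extChartAt_apply (x : N) (X : N → E) :
    modelDeriv I 𝓘(𝕜, E) (extChartAt I x) x (X x) = chartField I x X (extChartAt I x x) := by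
  have h : extChartAt I x ∘ (extChartAt I x).symm =ᶠ[𝓝 (extChartAt I x x)] id := by
    filter_upwards [extChartAt_target_mem_nhds x] with y hy using (extChartAt I x).right_inv hy
  rw [modelDeriv_apply_eq_fderiv_chartField (mem_extChartAt_source x)
    (mdifferentiableAt_extChartAt_self x), h.fderiv_eq, fderiv_id]
  rfl

theorem chartField_mlieBracket (x : N) (V W : N → E) :
    chartField I x (mlieBracket I V W) (extChartAt I x x) =
      lieBracket 𝕜 (chartField I x V) (chartField I x W) (extChartAt I x x) := by
  calc
    _ = modelDeriv I 𝓘(𝕜, E) (extChartAt I x) x (mlieBracket I V W x) :=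
      (modelDeriv_extChartAt_apply x (mlieBracket I V W)).symm
    _ = lieBracketWithin 𝕜 (chartField I x V) (chartField I x W)
          ((extChartAt I x).symm ⁻¹' Set.univ ∩ Set.range I) (extChartAt I x x) :=
      (isInvertible_mfderiv_extChartAt (mem_extChartAt_source x)).self_apply_inverse _
    _ = _ := by
      rw [I.range_eq_univ, Set.preimage_univ, Set.univ_inter, lieBracketWithin_univ]

end C1

variable [I.Boundaryless] [IsManifold I 2 N]

theorem contDiffAt_comp_extChartAt_symm {z : N → F} {x : N}
    (hz : ContMDiffAt I 𝓘(𝕜, F) 2 z x) :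
    ContDiffAt 𝕜 2 (z ∘ (extChartAt I x).symm) (extChartAt I x x) :=
  (hz.comp_of_eq (contMDiffAt_extChartAt_symm (mem_extChartAt_target x))
    (extChartAt_to_inv x)).contDiffAt

variable [CompleteSpace E]

theorem modelDeriv_modelDeriv_apply {z : N → F} {x : N}
    (hz : ContMDiff I 𝓘(𝕜, F) 2 z) (V : N → E) {W : N → E}
    (hW : MDifferentiableAt I I.tangent (fun p => (⟨p, W p⟩ : TangentBundle I N)) x) :
    modelDeriv I 𝓘(𝕜, F) (fun p => modelDeriv I 𝓘(𝕜, F) z p (W p)) x (V x) =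
      fderiv 𝕜 (fun y => fderiv 𝕜 (z ∘ (extChartAt I x).symm) y (chartField I x W y))
        (extChartAt I x x) (chartField I x V (extChartAt I x x)) := by
  have hζ := contDiffAt_comp_extChartAt_symm (hz x)
  have hWz : DifferentiableAt 𝕜
      (fun y => fderiv 𝕜 (z ∘ (extChartAt I x).symm) y (chartField I x W y))
      (extChartAt I x x) :=
    ((hζ.fderiv_right (m := 1) (by norm_num)).differentiableAt one_ne_zero).clm_apply
      (differentiableAt_chartField hW)
  have hchart : (fun p => modelDeriv I 𝓘(𝕜, F) z p (W p)) =ᶠ[𝓝 x]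
      (fun y => fderiv 𝕜 (z ∘ (extChartAt I x).symm) y (chartField I x W y)) ∘
        extChartAt I x := by
    filter_upwards [extChartAt_source_mem_nhds (I := I) x] with p hp
    exact modelDeriv_apply_eq_fderiv_chartField hp (hz.mdifferentiable two_ne_zero p) W
  rw [modelDeriv_congr hchart, modelDeriv_comp_of_eq hWz.mdifferentiableAt
    (mdifferentiableAt_extChartAt_self x) rfl, modelDeriv_eq_fderiv,
    ContinuousLinearMap.comp_apply, modelDeriv_extChartAt_apply]

theorem modelDeriv_mlieBracket [IsRCLikeNormedField 𝕜] {z : N → F} {x : N}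
    (hz : ContMDiff I 𝓘(𝕜, F) 2 z) {V W : N → E}
    (hV : MDifferentiableAt I I.tangent (fun p => (⟨p, V p⟩ : TangentBundle I N)) x)
    (hW : MDifferentiableAt I I.tangent (fun p => (⟨p, W p⟩ : TangentBundle I N)) x) :
    modelDeriv I 𝓘(𝕜, F) z x (mlieBracket I V W x) =
      modelDeriv I 𝓘(𝕜, F) (fun p => modelDeriv I 𝓘(𝕜, F) z p (W p)) x (V x) -
        modelDeriv I 𝓘(𝕜, F) (fun p => modelDeriv I 𝓘(𝕜, F) z p (V p)) x (W x) := by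
  refine (modelDeriv_apply_eq_fderiv_chartField (mem_extChartAt_source x)
    (hz.mdifferentiable two_ne_zero x) (mlieBracket I V W)).trans ?_
  rw [chartField_mlieBracket, modelDeriv_modelDeriv_apply hz V hW,
    modelDeriv_modelDeriv_apply hz W hV]
  exact fderiv_apply_lieBracket (contDiffAt_comp_extChartAt_symm (hz x))
    minSmoothness_of_isRCLikeNormedField.le (differentiableAt_chartField hW)
    (differentiableAt_chartField hV)

end Derivation

/-! ### Transport of post-Lie structures -/

section PostLie

variable {k : Type*} [Field k]

theorem isLieBracket_lie {L : Type*} [LieRing L] [LieAlgebra k L] :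
    IsLieBracket k (fun x y : L => ⁅x, y⁆) where
  add_left := add_lie
  smul_left := smul_lie
  add_right := lie_add
  smul_right c x y := lie_smul c x y
  self := lie_self
  jacobi x y z := by
    rw [← lie_skew ⁅x, y⁆, ← lie_skew ⁅y, z⁆, ← lie_skew ⁅z, x⁆, ← neg_add, ← neg_add,
      neg_eq_zero, ← lie_jacobi x y z]
    abel

variable {A A' : Type*} [AddCommGroup A] [Module k A] [AddCommGroup A'] [Module k A']

theorem IsLieBracket.transport {br : A → A → A} (h : IsLieBracket k br) (e : A ≃ₗ[k] A') :
    IsLieBracket k (fun x y => e (br (e.symm x) (e.symm y))) where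
  add_left x y z := by rw [map_add, h.add_left, map_add]
  smul_left c x y := by rw [map_smul, h.smul_left, map_smul]
  add_right x y z := by rw [map_add, h.add_right, map_add]
  smul_right c x y := by rw [map_smul, h.smul_right, map_smul]
  self x := by rw [h.self, map_zero]
  jacobi x y z := by
    simp only [LinearEquiv.symm_apply_apply]
    rw [← map_add, ← map_add, h.jacobi, map_zero]

theorem IsPostLie.transport {br tr : A → A → A} (h : IsPostLie k br tr) (e : A ≃ₗ[k] A') :
    IsPostLie k (fun x y => e (br (e.symm x) (e.symm y)))
      (fun x y => e (tr (e.symm x) (e.symm y))) where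
  lie := h.lie.transport e
  add_left x y z := by rw [map_add, h.add_left, map_add]
  smul_left c x y := by rw [map_smul, h.smul_left, map_smul]
  add_right x y z := by rw [map_add, h.add_right, map_add]
  smul_right c x y := by rw [map_smul, h.smul_right, map_smul]
  derivation x y z := by
    simp only [LinearEquiv.symm_apply_apply]
    rw [h.derivation, map_add]
  bracket_tr x y z := by
    simp only [productAssociator, LinearEquiv.symm_apply_apply]
    rw [h.bracket_tr, productAssociator, productAssociator, map_sub, map_sub, map_sub]

end PostLie

noncomputable section

namespace AtiyahPostLie

open Module Topology VectorField

/-! ### Local sections of the orbit map -/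

section Orbit

variable {𝕜 : Type*} [NontriviallyNormedField 𝕜]
  {E : Type*} [NormedAddCommGroup E] [NormedSpace 𝕜 E]
  {B : Type*} [TopologicalSpace B] {I : ModelWithCorners 𝕜 E B}
  {G : Type*} [TopologicalSpace G] [ChartedSpace B G] [Group G]
  {E' : Type*} [NormedAddCommGroup E'] [NormedSpace 𝕜 E']
  {B' : Type*} [TopologicalSpace B'] {I' : ModelWithCorners 𝕜 E' B'}
  {M : Type*} [TopologicalSpace M] [ChartedSpace B' M] [MulAction G M]

section LieGroup

variable [LieGroup I ∞ G]

theorem mdifferentiable_mul_left (g : G) : MDifferentiable I I (fun a : G => g * a) :=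
  (contMDiff_mul_left (I := I) (n := ∞) (a := g)).mdifferentiable (by simp)

theorem surjective_modelDeriv_mul_left (g : G) :
    Function.Surjective (modelDeriv I I (fun a : G => g * a) 1) := by
  have h := modelDeriv_comp_of_leftInverse (mdifferentiable_mul_left (I := I) g 1)
    (mdifferentiable_mul_left g⁻¹ g) (inv_mul_cancel g) (mul_inv_cancel_left g)
  exact Function.RightInverse.surjective (DFunLike.congr_fun h)

end LieGroup

variable (I I') in
theorem mdifferentiable_const_smul [ContMDiffSMul I I' ∞ G M] (g : G) :
    MDifferentiable I' I' (fun u : M => g • u) :=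
  (ContMDiffSMul.contMDiff_const_smul (I := I) (n := ∞) g).mdifferentiable (by simp)

variable (I) in
theorem injective_modelDeriv_const_smul [ContMDiffSMul I I' ∞ G M] (g : G) (u : M) :
    Function.Injective (modelDeriv I' I' (fun u : M => g • u) u) := by
  have h := modelDeriv_comp_of_leftInverse (mdifferentiable_const_smul I I' g⁻¹ (g • u))
    (mdifferentiable_const_smul I I' g u) rfl (inv_smul_smul g)
  exact Function.LeftInverse.injective (DFunLike.congr_fun h)

variable [ContMDiffSMul I I' ∞ G M]

variable (I I' G) in
theorem contMDiff_orbitMap (o : M) : ContMDiff I I' ∞ (fun g : G => g • o) :=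
  contMDiff_id.smul contMDiff_const

variable [LieGroup I ∞ G]

theorem modelDeriv_orbitMap_comp_mul_left (o : M) (g : G) :
    modelDeriv I I' (fun a : G => a • o) g ∘L modelDeriv I I (fun a : G => g * a) 1 =
      modelDeriv I' I' (fun u : M => g • u) o ∘L modelDeriv I I' (fun a : G => a • o) 1 := by
  have hπ := (contMDiff_orbitMap I G I' o).mdifferentiable (by simp)
  rw [← modelDeriv_comp_of_eq (hπ g) (mdifferentiable_mul_left g 1) (mul_one g),
    ← modelDeriv_comp_of_eq (mdifferentiable_const_smul I I' g o) (hπ 1) (one_smul G o)]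
  congr 1
  ext a
  exact mul_smul g a o

theorem finrank_range_modelDeriv_orbitMap (o : M) (g : G) :
    finrank 𝕜 (modelDeriv I I' (fun a : G => a • o) g).range =
      finrank 𝕜 (modelDeriv I I' (fun a : G => a • o) 1).range := by
  calc
    _ = finrank 𝕜 (modelDeriv I I' (fun a : G => a • o) g ∘L
          modelDeriv I I (fun a : G => g * a) 1).range :=
      (finrank_range_comp_comp_of_injective_of_surjective _ (a := LinearMap.id)
        Function.injective_id (surjective_modelDeriv_mul_left g)).symm
    _ = finrank 𝕜 (modelDeriv I' I' (fun u : M => g • u) o ∘L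
          modelDeriv I I' (fun a : G => a • o) 1).range := by
      rw [modelDeriv_orbitMap_comp_mul_left]
    _ = _ :=
      finrank_range_comp_comp_of_injective_of_surjective _ (c := LinearMap.id)
        (injective_modelDeriv_const_smul I g o) Function.surjective_id

end Orbit

section CartanGauge

variable {E : Type*} [NormedAddCommGroup E] [NormedSpace ℝ E] [FiniteDimensional ℝ E]
  {B : Type*} [TopologicalSpace B] {I : ModelWithCorners ℝ E B} [I.Boundaryless]
  {G : Type*} [TopologicalSpace G] [ChartedSpace B G] [Group G] [LieGroup I ∞ G]
  [SecondCountableTopology G]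
  {E' : Type*} [NormedAddCommGroup E'] [NormedSpace ℝ E'] [FiniteDimensional ℝ E']
  {B' : Type*} [TopologicalSpace B'] {I' : ModelWithCorners ℝ E' B'} [I'.Boundaryless]
  {M : Type*} [TopologicalSpace M] [ChartedSpace B' M] [IsManifold I' ∞ M]
  [MulAction G M] [ContMDiffSMul I I' ∞ G M] [MulAction.IsPretransitive G M]

theorem surjective_modelDeriv_orbitMap (o : M) (g : G) :
    Function.Surjective (modelDeriv I I' (fun a : G => a • o) g) :=
  surjective_modelDeriv_of_surjective_of_constant_rank (MulAction.surjective_smul G o)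
    ((contMDiff_orbitMap I G I' o).of_le (by simp)) (finrank_range_modelDeriv_orbitMap o) g

variable (I I' G) in
theorem exists_isCartanGauge (o u : M) :
    ∃ (U : Set M) (σ : M → G), u ∈ U ∧ IsCartanGauge I I' o U σ := by
  have : CompleteSpace E := FiniteDimensional.complete ℝ E
  obtain ⟨g, rfl⟩ := MulAction.exists_smul_eq G o u
  obtain ⟨U, σ, hU, hgU, hσ, h⟩ := exists_contMDiffOn_rightInverse (by simp)
    (contMDiff_orbitMap I G I' o) (surjective_modelDeriv_orbitMap o g)
  exact ⟨U, σ, hgU, hU, hσ, h⟩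

end CartanGauge

/-! ### Derivatives in the left trivialization -/

section Family

variable {𝕜 : Type*} [NontriviallyNormedField 𝕜]
  {E₁ : Type*} [NormedAddCommGroup E₁] [NormedSpace 𝕜 E₁]
  {B₁ : Type*} [TopologicalSpace B₁] {I₁ : ModelWithCorners 𝕜 E₁ B₁}
  {N : Type*} [TopologicalSpace N] [ChartedSpace B₁ N] [IsManifold I₁ ∞ N]
  {E₂ : Type*} [NormedAddCommGroup E₂] [NormedSpace 𝕜 E₂]
  {B₂ : Type*} [TopologicalSpace B₂] {I₂ : ModelWithCorners 𝕜 E₂ B₂}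
  {M : Type*} [TopologicalSpace M] [ChartedSpace B₂ M] [IsManifold I₂ ∞ M]
  {E₃ : Type*} [NormedAddCommGroup E₃] [NormedSpace 𝕜 E₃]
  {B₃ : Type*} [TopologicalSpace B₃] {I₃ : ModelWithCorners 𝕜 E₃ B₃}
  {P : Type*} [TopologicalSpace P] [ChartedSpace B₃ P] [IsManifold I₃ ∞ P]
  {F : Type*} [NormedAddCommGroup F] [NormedSpace 𝕜 F]

theorem tangentBundleCore_coordChange_achart_of_const {X : Type*} {m : M} {f : X → M}
    (hf : ∀ x, f x = m) (x₀ x : X) :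
    (tangentBundleCore I₂ M).coordChange (achart B₂ (f x)) (achart B₂ (f x₀)) (f x) =
      ContinuousLinearMap.id 𝕜 E₂ := by
  rw [hf, hf]
  ext v
  exact (tangentBundleCore I₂ M).coordChange_self _ _ (mem_chart_source B₂ m) v

theorem contMDiff_modelDeriv_of_fixed {f : N → M → P} {m : M} {p : P}
    (hf : ContMDiff (I₁.prod I₂) I₃ ∞ (Function.uncurry f)) (hp : ∀ x, f x m = p) :
    ContMDiff I₁ 𝓘(𝕜, E₂ →L[𝕜] E₃) ∞ (fun x => modelDeriv I₂ I₃ (f x) m) := by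
  intro x₀
  have h : ContMDiffAt I₁ 𝓘(𝕜, E₂ →L[𝕜] E₃) ∞ (inTangentCoordinates I₂ I₃ (fun _ : N => m)
      (fun x => f x m) (fun x => modelDeriv I₂ I₃ (f x) m) x₀) x₀ :=
    ContMDiffAt.mfderiv (n := ∞) f (fun _ : N => m) hf.contMDiffAt contMDiffAt_const (by simp)
  convert! h using 1
  ext1 x
  rw [inTangentCoordinates_eq _ _ _ (mem_chart_source B₂ m) (by
    rw [hp x, hp x₀]
    exact mem_chart_source B₃ p),
    tangentBundleCore_coordChange_achart_of_const (I₂ := I₃) (f := fun x => f x m) hp x₀ x,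
    tangentBundleCore_coordChange_achart_of_const (f := fun _ : N => m) (fun _ => rfl) x x₀]
  rfl

theorem contMDiff_modelDeriv_of_vectorValued {f : N → M → F} {m : M}
    (hf : ContMDiff (I₁.prod I₂) 𝓘(𝕜, F) ∞ (Function.uncurry f)) :
    ContMDiff I₁ 𝓘(𝕜, E₂ →L[𝕜] F) ∞ (fun x => modelDeriv I₂ 𝓘(𝕜, F) (f x) m) := by
  intro x₀
  have h : ContMDiffAt I₁ 𝓘(𝕜, E₂ →L[𝕜] F) ∞ (inTangentCoordinates I₂ 𝓘(𝕜, F) (fun _ : N => m)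
      (fun x => f x m) (fun x => modelDeriv I₂ 𝓘(𝕜, F) (f x) m) x₀) x₀ :=
    ContMDiffAt.mfderiv (n := ∞) f (fun _ : N => m) hf.contMDiffAt contMDiffAt_const (by simp)
  convert! h using 1
  ext1 x
  rw [inTangentCoordinates_eq _ _ _ (mem_chart_source B₂ m) (Set.mem_univ _),
    tangentBundleCore_coordChange_achart_of_const (f := fun _ : N => m) (fun _ => rfl) x x₀]
  simp only [tangentBundleCore_coordChange_model_space]
  rfl

end Family

section LeftDeriv

variable {𝕜 : Type*} [NontriviallyNormedField 𝕜]
  {E : Type*} [NormedAddCommGroup E] [NormedSpace 𝕜 E]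
  {B : Type*} [TopologicalSpace B] {I : ModelWithCorners 𝕜 E B}
  {G : Type*} [TopologicalSpace G] [ChartedSpace B G] [Group G]
  {F : Type*} [NormedAddCommGroup F] [NormedSpace 𝕜 F]
  {F₁ : Type*} [NormedAddCommGroup F₁] [NormedSpace 𝕜 F₁]
  {F₂ : Type*} [NormedAddCommGroup F₂] [NormedSpace 𝕜 F₂]

variable (I) in
/-- The derivative of a vector-valued function `y` at `g` in the left trivialization `TG = G × 𝔤`:
the value of `leftDeriv I y g` at `v` is the derivative of `y` along the left-invariant vector
field of `v`. -/
def leftDeriv (y : G → F) (g : G) : E →L[𝕜] F :=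
  modelDeriv I 𝓘(𝕜, F) (fun a => y (g * a)) 1

theorem leftDeriv_const (c : F) (g : G) : leftDeriv I (fun _ : G => c) g = 0 :=
  mfderiv_const

variable [LieGroup I ∞ G]

theorem contMDiff_leftDeriv {y : G → F} (hy : ContMDiff I 𝓘(𝕜, F) ∞ y) :
    ContMDiff I 𝓘(𝕜, E →L[𝕜] F) ∞ (leftDeriv I y) :=
  contMDiff_modelDeriv_of_vectorValued (f := fun g a : G => y (g * a))
    (hy.comp (contMDiff_mul I ∞))

theorem mdifferentiable_comp_mul_left {y : G → F} (hy : MDifferentiable I 𝓘(𝕜, F) y) (g : G) :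
    MDifferentiable I 𝓘(𝕜, F) (fun a => y (g * a)) :=
  hy.comp (mdifferentiable_mul_left g)

theorem leftDeriv_eq_comp {y : G → F} (hy : MDifferentiable I 𝓘(𝕜, F) y) (g : G) :
    leftDeriv I y g = modelDeriv I 𝓘(𝕜, F) y g ∘L modelDeriv I I (fun a : G => g * a) 1 :=
  modelDeriv_comp_of_eq (hy g) (mdifferentiable_mul_left g 1) (mul_one g)

theorem leftDeriv_add {y z : G → F} (hy : MDifferentiable I 𝓘(𝕜, F) y)
    (hz : MDifferentiable I 𝓘(𝕜, F) z) (g : G) :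
    leftDeriv I (fun g => y g + z g) g = leftDeriv I y g + leftDeriv I z g :=
  mfderiv_add (mdifferentiable_comp_mul_left hy g 1) (mdifferentiable_comp_mul_left hz g 1)

theorem leftDeriv_const_smul (c : 𝕜) {y : G → F} (hy : MDifferentiable I 𝓘(𝕜, F) y) (g : G) :
    leftDeriv I (fun g => c • y g) g = c • leftDeriv I y g :=
  const_smul_mfderiv (mdifferentiable_comp_mul_left hy g 1) c

theorem leftDeriv_clm_comp (L : F →L[𝕜] F₁) {y : G → F} (hy : MDifferentiable I 𝓘(𝕜, F) y)
    (g : G) : leftDeriv I (fun g => L (y g)) g = L ∘L leftDeriv I y g := by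
  have h := modelDeriv_comp_of_eq (I'' := 𝓘(𝕜, F₁)) L.differentiableAt.mdifferentiableAt
    (mdifferentiable_comp_mul_left hy g 1) rfl
  rwa [modelDeriv_eq_fderiv, L.fderiv] at h

theorem leftDeriv_bilinear (β : F₁ →L[𝕜] F₂ →L[𝕜] F) {y : G → F₁} {z : G → F₂}
    (hy : MDifferentiable I 𝓘(𝕜, F₁) y) (hz : MDifferentiable I 𝓘(𝕜, F₂) z) (g : G) (v : E) :
    leftDeriv I (fun g => β (y g) (z g)) g v =
      β (leftDeriv I y g v) (z g) + β (y g) (leftDeriv I z g v) := by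
  have hβ : HasFDerivAt (fun p : F₁ × F₂ => β p.1 p.2)
      (β.isBoundedBilinearMap.deriv (y (g * 1), z (g * 1))) (y (g * 1), z (g * 1)) :=
    β.isBoundedBilinearMap.hasFDerivAt _
  have hy' := mdifferentiable_comp_mul_left hy g 1
  have hz' := mdifferentiable_comp_mul_left hz g 1
  have hyz : HasMFDerivAt I 𝓘(𝕜, F₁ × F₂) (fun a => (y (g * a), z (g * a))) (1 : G)
      ((leftDeriv I y g).prod (leftDeriv I z g)) :=
    ⟨hy'.continuousAt.prodMk hz'.continuousAt, hy'.hasMFDerivAt.2.prodMk hz'.hasMFDerivAt.2⟩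
  have hβyz := HasMFDerivAt.comp (I' := 𝓘(𝕜, F₁ × F₂)) (1 : G) hβ.hasMFDerivAt hyz
  have h : leftDeriv I (fun g => β (y g) (z g)) g =
      β.isBoundedBilinearMap.deriv (y (g * 1), z (g * 1)) ∘L
        (leftDeriv I y g).prod (leftDeriv I z g) := hβyz.mfderiv
  rw [h, mul_one]
  exact add_comm _ _

theorem leftDeriv_clm_apply {A : G → F₁ →L[𝕜] F} {x : G → F₁}
    (hA : MDifferentiable I 𝓘(𝕜, F₁ →L[𝕜] F) A) (hx : MDifferentiable I 𝓘(𝕜, F₁) x) (g : G)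
    (v : E) :
    leftDeriv I (fun g => A g (x g)) g v = leftDeriv I A g v (x g) + A g (leftDeriv I x g v) :=
  leftDeriv_bilinear (ContinuousLinearMap.id 𝕜 (F₁ →L[𝕜] F)) hA hx g v

theorem modelDeriv_mulInvariantVectorField {y : G → F} (hy : MDifferentiable I 𝓘(𝕜, F) y)
    (v : GroupLieAlgebra I G) (g : G) :
    modelDeriv I 𝓘(𝕜, F) y g (mulInvariantVectorField v g) = leftDeriv I y g v :=
  (DFunLike.congr_fun (leftDeriv_eq_comp hy g) v).symm

theorem leftDeriv_leftDeriv_apply {z : G → F} (hz : ContMDiff I 𝓘(𝕜, F) ∞ z) (g : G) (v w : E) :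
    leftDeriv I (fun a => leftDeriv I z a w) g v = leftDeriv I (leftDeriv I z) g v w := by
  rw [leftDeriv_clm_apply ((contMDiff_leftDeriv hz).mdifferentiable (by simp))
    mdifferentiable_const, leftDeriv_const, zero_apply, map_zero, add_zero]

theorem modelDeriv_modelDeriv_mulInvariantVectorField {z : G → F}
    (hz : ContMDiff I 𝓘(𝕜, F) ∞ z) (v w : GroupLieAlgebra I G) (g : G) :
    modelDeriv I 𝓘(𝕜, F) (fun a => modelDeriv I 𝓘(𝕜, F) z a (mulInvariantVectorField w a)) g
        (mulInvariantVectorField v g) =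
      leftDeriv I (leftDeriv I z) g v w := by
  have hDz : (fun a => modelDeriv I 𝓘(𝕜, F) z a (mulInvariantVectorField w a)) =
      fun a => leftDeriv I z a w :=
    funext (modelDeriv_mulInvariantVectorField (hz.mdifferentiable (by simp)) w)
  have hDz_smooth : ContMDiff I 𝓘(𝕜, F) ∞ (fun a => leftDeriv I z a w) :=
    (contMDiff_leftDeriv hz).clm_apply contMDiff_const
  rw [hDz]
  exact (modelDeriv_mulInvariantVectorField (hDz_smooth.mdifferentiable (by simp)) v g).trans
    (leftDeriv_leftDeriv_apply hz g v w)

variable [IsRCLikeNormedField 𝕜]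

instance lieGroup_minSmoothness_three : LieGroup I (minSmoothness 𝕜 3) G :=
  LieGroup.of_le (n := ∞) (by
    rw [minSmoothness_of_isRCLikeNormedField]
    exact ENat.LEInfty.out)

theorem leftDeriv_leftDeriv_sub_swap [I.Boundaryless] [CompleteSpace E] {z : G → F}
    (hz : ContMDiff I 𝓘(𝕜, F) ∞ z) (g : G) (v w : GroupLieAlgebra I G) :
    leftDeriv I (leftDeriv I z) g v w - leftDeriv I (leftDeriv I z) g w v =
      leftDeriv I z g (⁅v, w⁆ : GroupLieAlgebra I G) := by
  rw [← modelDeriv_modelDeriv_mulInvariantVectorField hz v w,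
    ← modelDeriv_modelDeriv_mulInvariantVectorField hz w v,
    ← modelDeriv_mulInvariantVectorField (hz.mdifferentiable (by simp)),
    GroupLieAlgebra.bracket_def, mulInvariantVector_mlieBracket v w]
  exact (modelDeriv_mlieBracket (hz.of_le ENat.LEInfty.out)
    (mdifferentiableAt_mulInvariantVectorField v)
    (mdifferentiableAt_mulInvariantVectorField w)).symm

end LeftDeriv

/-! ### The adjoint representation -/

section Adjoint

variable {E : Type*} [NormedAddCommGroup E] [NormedSpace ℝ E]
  {B : Type*} [TopologicalSpace B] {I : ModelWithCorners ℝ E B}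
  {G : Type*} [TopologicalSpace G] [ChartedSpace B G] [Group G]

variable (I) in
/-- The adjoint representation `Ad g`, as a continuous linear map of the model space. -/
def AdCLM (g : G) : E →L[ℝ] E := modelDeriv I I (fun a : G => g * a * g⁻¹) 1

theorem mulInvariantVectorField_one (v : GroupLieAlgebra I G) :
    mulInvariantVectorField v (1 : G) = v := by
  have h : (fun a : G => (1 : G) * a) = id := funext one_mul
  unfold mulInvariantVectorField
  rw [h, mfderiv_id]
  rfl

variable [LieGroup I ∞ G]

theorem contMDiff_AdCLM : ContMDiff I 𝓘(ℝ, E →L[ℝ] E) ∞ (AdCLM I : G → E →L[ℝ] E) :=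
  contMDiff_modelDeriv_of_fixed (f := fun g a : G => g * a * g⁻¹) (p := 1)
    ((contMDiff_fst.mul contMDiff_snd).mul contMDiff_fst.inv) (by simp)

theorem contMDiff_conj (g : G) : ContMDiff I I ∞ (fun a : G => g * a * g⁻¹) :=
  (contMDiff_const.mul contMDiff_id).mul contMDiff_const

theorem mdifferentiable_conj (g : G) : MDifferentiable I I (fun a : G => g * a * g⁻¹) :=
  (contMDiff_conj g).mdifferentiable (by simp)

theorem isInvertible_mfderiv_conj (g a : G) :
    (mfderiv I I (fun a : G => g * a * g⁻¹) a).IsInvertible := by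
  have hinv : g⁻¹ * (g * a * g⁻¹) * g⁻¹⁻¹ = a := by group
  have hright := modelDeriv_comp_of_leftInverse (mdifferentiable_conj (I := I) g a)
    (mdifferentiable_conj g⁻¹ (g * a * g⁻¹)) hinv (fun b => by group)
  have hleft := modelDeriv_comp_of_leftInverse
    (mdifferentiable_conj (I := I) g⁻¹ (g * a * g⁻¹)) (mdifferentiable_conj g a) rfl
    (fun b => by group)
  exact ContinuousLinearMap.IsInvertible.of_inverse hright hleft

theorem modelDeriv_mul_left_comp_AdCLM (g a : G) :
    modelDeriv I I (fun b : G => g * a * g⁻¹ * b) 1 ∘L AdCLM I g =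
      modelDeriv I I (fun b : G => g * b * g⁻¹) a ∘L modelDeriv I I (fun b : G => a * b) 1 := by
  rw [AdCLM, ← modelDeriv_comp_of_eq (mdifferentiable_mul_left _ _) (mdifferentiable_conj g 1)
    (by simp), ← modelDeriv_comp_of_eq (mdifferentiable_conj g a) (mdifferentiable_mul_left _ _)
    (mul_one a)]
  congr 1
  ext b
  simp [mul_assoc]

theorem mpullback_conj_mulInvariantVectorField (g : G) (v : GroupLieAlgebra I G) :
    mpullback I I (fun a : G => g * a * g⁻¹) (mulInvariantVectorField (Ad g v)) =
      mulInvariantVectorField v := by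
  ext1 a
  have h : (mulInvariantVectorField (Ad g v) (g * a * g⁻¹) : TangentSpace I (g * a * g⁻¹)) =
      mfderiv I I (fun a : G => g * a * g⁻¹) a (mulInvariantVectorField v a) :=
    DFunLike.congr_fun (modelDeriv_mul_left_comp_AdCLM (I := I) g a) v
  rw [mpullback_apply, h]
  exact (isInvertible_mfderiv_conj g a).inverse_apply_self _

theorem Ad_lie [CompleteSpace E] (g : G) (v w : GroupLieAlgebra I G) :
    Ad g ⁅v, w⁆ = ⁅Ad g v, Ad g w⁆ := by
  have hpullback := mpullback_mlieBracket (f := fun a : G => g * a * g⁻¹) (x₀ := 1) (n := ∞)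
    (mdifferentiableAt_mulInvariantVectorField (Ad g v))
    (mdifferentiableAt_mulInvariantVectorField (Ad g w)) (contMDiff_conj g).contMDiffAt (by
      rw [minSmoothness_of_isRCLikeNormedField]
      exact ENat.LEInfty.out)
  have hAd : Ad g (Ad g⁻¹ ⁅Ad g v, Ad g w⁆) = ⁅Ad g v, Ad g w⁆ := by
    rw [← Ad_mul, mul_inv_cancel, Ad_one]
  rw [mpullback_conj_mulInvariantVectorField, mpullback_conj_mulInvariantVectorField,
    ← mulInvariantVector_mlieBracket (Ad g v), ← GroupLieAlgebra.bracket_def,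
    ← GroupLieAlgebra.bracket_def, ← hAd, mpullback_conj_mulInvariantVectorField,
    mulInvariantVectorField_one] at hpullback
  rw [← hpullback, hAd]

end Adjoint

/-! ### The post-Lie algebra of equivariant functions -/

section Triangle

variable {E : Type*} [NormedAddCommGroup E] [NormedSpace ℝ E]
  {B : Type*} [TopologicalSpace B] {I : ModelWithCorners ℝ E B}
  {G : Type*} [TopologicalSpace G] [ChartedSpace B G] [Group G]
  {x y z : G → GroupLieAlgebra I G}

theorem mdifferentiable_of_mem_smoothFunctions (hy : y ∈ smoothFunctions I G) :
    MDifferentiable I 𝓘(ℝ, E) (M' := E) y :=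
  ContMDiff.mdifferentiable (M' := E) hy (by simp)

variable [LieGroup I ∞ G]

theorem triangle_eq_leftDeriv (x : G → GroupLieAlgebra I G) (hy : y ∈ smoothFunctions I G) :
    triangle x y = fun g => leftDeriv (F := E) I y g (x g) :=
  funext fun g => (modelDeriv_mulInvariantVectorField (F := E)
    (mdifferentiable_of_mem_smoothFunctions hy) (x g) g)

theorem triangle_mem_smoothFunctions (hx : x ∈ smoothFunctions I G)
    (hy : y ∈ smoothFunctions I G) : triangle x y ∈ smoothFunctions I G := by
  rw [triangle_eq_leftDeriv x hy]
  exact (contMDiff_leftDeriv (F := E) hy).clm_apply hx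

theorem triangle_add_left (x y : G → GroupLieAlgebra I G) (hz : z ∈ smoothFunctions I G) :
    triangle (x + y) z = triangle x z + triangle y z := by
  rw [triangle_eq_leftDeriv _ hz, triangle_eq_leftDeriv _ hz, triangle_eq_leftDeriv _ hz]
  exact funext fun g => map_add (leftDeriv (F := E) I z g) (x g) (y g)

theorem triangle_smul_left (c : ℝ) (x : G → GroupLieAlgebra I G) (hy : y ∈ smoothFunctions I G) :
    triangle (c • x) y = c • triangle x y := by
  rw [triangle_eq_leftDeriv _ hy, triangle_eq_leftDeriv _ hy]
  exact funext fun g => map_smul (leftDeriv (F := E) I y g) c (x g)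

theorem triangle_add_right (x : G → GroupLieAlgebra I G) (hy : y ∈ smoothFunctions I G)
    (hz : z ∈ smoothFunctions I G) : triangle x (y + z) = triangle x y + triangle x z := by
  rw [triangle_eq_leftDeriv _ (add_mem hy hz), triangle_eq_leftDeriv _ hy,
    triangle_eq_leftDeriv _ hz]
  exact funext fun g => DFunLike.congr_fun (leftDeriv_add (F := E)
    (mdifferentiable_of_mem_smoothFunctions hy) (mdifferentiable_of_mem_smoothFunctions hz) g) (x g)

theorem triangle_smul_right (c : ℝ) (x : G → GroupLieAlgebra I G)
    (hy : y ∈ smoothFunctions I G) : triangle x (c • y) = c • triangle x y := by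
  rw [triangle_eq_leftDeriv _ (Submodule.smul_mem _ c hy), triangle_eq_leftDeriv _ hy]
  exact funext fun g => DFunLike.congr_fun (leftDeriv_const_smul (F := E) c
    (mdifferentiable_of_mem_smoothFunctions hy) g) (x g)

theorem triangle_triangle (x : G → GroupLieAlgebra I G) (hy : y ∈ smoothFunctions I G)
    (hz : z ∈ smoothFunctions I G) :
    triangle x (triangle y z) = fun g => leftDeriv (F := E →L[ℝ] E) I (leftDeriv (F := E) I z) g
      (x g) (y g) + leftDeriv (F := E) I z g (leftDeriv (F := E) I y g (x g)) := by
  rw [triangle_eq_leftDeriv _ (triangle_mem_smoothFunctions hy hz), triangle_eq_leftDeriv y hz]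
  exact funext fun g => leftDeriv_clm_apply (F := E)
    ((contMDiff_leftDeriv (F := E) hz).mdifferentiable (by simp))
    (mdifferentiable_of_mem_smoothFunctions hy) g (x g)

theorem productAssociator_triangle (x : G → GroupLieAlgebra I G) (hy : y ∈ smoothFunctions I G)
    (hz : z ∈ smoothFunctions I G) :
    productAssociator triangle x y z =
      fun g => leftDeriv (F := E →L[ℝ] E) I (leftDeriv (F := E) I z) g (x g) (y g) := by
  rw [productAssociator, triangle_triangle x hy hz, triangle_eq_leftDeriv _ hz,
    triangle_eq_leftDeriv x hy]
  exact funext fun g => add_sub_cancel_right (G := E) _ _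

theorem triangle_bracket_left [I.Boundaryless] [CompleteSpace E] (hx : x ∈ smoothFunctions I G)
    (hy : y ∈ smoothFunctions I G) (hz : z ∈ smoothFunctions I G) :
    triangle (bracket x y) z =
      productAssociator triangle x y z - productAssociator triangle y x z := by
  rw [productAssociator_triangle x hy hz, productAssociator_triangle y hx hz,
    triangle_eq_leftDeriv _ hz]
  exact funext fun g => (leftDeriv_leftDeriv_sub_swap (F := E) hz g (x g) (y g)).symm

section Bracket

variable [FiniteDimensional ℝ E]

variable (I G) in
/-- The bracket of the Lie algebra, as a continuous bilinear map of the model space. -/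
def bracketCLM : E →L[ℝ] E →L[ℝ] E :=
  have : CompleteSpace E := FiniteDimensional.complete ℝ E
  let lieMap : GroupLieAlgebra I G →ₗ[ℝ] GroupLieAlgebra I G →ₗ[ℝ] GroupLieAlgebra I G :=
    LinearMap.mk₂ ℝ (fun v w => ⁅v, w⁆) (fun u v w => add_lie u v w) (fun c v w => smul_lie c v w)
      (fun u v w => lie_add u v w) (fun c v w => lie_smul c v w)
  LinearMap.toContinuousBilinearMap (E := E) (F := E) (G := E) lieMap

theorem bracket_mem_smoothFunctions (hx : x ∈ smoothFunctions I G)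
    (hy : y ∈ smoothFunctions I G) : bracket x y ∈ smoothFunctions I G :=
  ((bracketCLM I G).contDiff.contMDiff.comp hx).clm_apply hy

theorem triangle_bracket_right (x : G → GroupLieAlgebra I G) (hy : y ∈ smoothFunctions I G)
    (hz : z ∈ smoothFunctions I G) :
    triangle x (bracket y z) = bracket (triangle x y) z + bracket y (triangle x z) := by
  rw [triangle_eq_leftDeriv _ (bracket_mem_smoothFunctions hy hz), triangle_eq_leftDeriv _ hy,
    triangle_eq_leftDeriv _ hz]
  exact funext fun g => leftDeriv_bilinear (bracketCLM I G)
    (mdifferentiable_of_mem_smoothFunctions hy) (mdifferentiable_of_mem_smoothFunctions hz) g (x g)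

end Bracket

end Triangle

section Equivariant

variable {E : Type*} [NormedAddCommGroup E] [NormedSpace ℝ E]
  {B : Type*} [TopologicalSpace B] {I : ModelWithCorners ℝ E B}
  {G : Type*} [TopologicalSpace G] [ChartedSpace B G] [Group G] [LieGroup I ∞ G]
  {H : Subgroup G} {x y : G → GroupLieAlgebra I G}

theorem leftDeriv_mul_comp_AdCLM {y : G → E} (hy : MDifferentiable I 𝓘(ℝ, E) y) {h : G}
    (hyh : ∀ g, y (g * h) = AdCLM I h⁻¹ (y g)) (g : G) :
    leftDeriv I y (g * h) ∘L AdCLM I h⁻¹ = AdCLM I h⁻¹ ∘L leftDeriv I y g := by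
  rw [← leftDeriv_clm_comp _ hy, AdCLM, leftDeriv, leftDeriv, ← modelDeriv_comp_of_eq
    (mdifferentiable_comp_mul_left hy (g * h) 1) (mdifferentiable_conj h⁻¹ 1) (by simp)]
  congr 1
  ext1 a
  rw [← AdCLM, ← hyh]
  simp [mul_assoc]

theorem triangle_mem_equivariantFunctions (hx : x ∈ equivariantFunctions I H)
    (hy : y ∈ equivariantFunctions I H) : triangle x y ∈ equivariantFunctions I H := by
  refine ⟨triangle_mem_smoothFunctions hx.1 hy.1, fun g h hh => ?_⟩
  rw [triangle_eq_leftDeriv x hy.1]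
  have hderiv : leftDeriv (F := E) I y (g * h) ∘L AdCLM I h⁻¹ =
      AdCLM I h⁻¹ ∘L leftDeriv (F := E) I y g :=
    leftDeriv_mul_comp_AdCLM (mdifferentiable_of_mem_smoothFunctions hy.1)
      (fun g => hy.2 g h hh) g
  exact (congrArg (fun v : E => leftDeriv (F := E) I y (g * h) v) (hx.2 g h hh)).trans
    (DFunLike.congr_fun hderiv (x g))

variable [FiniteDimensional ℝ E]

theorem bracket_mem_equivariantFunctions (hx : x ∈ equivariantFunctions I H)
    (hy : y ∈ equivariantFunctions I H) : bracket x y ∈ equivariantFunctions I H := by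
  have : CompleteSpace E := FiniteDimensional.complete ℝ E
  refine ⟨bracket_mem_smoothFunctions hx.1 hy.1, fun g h hh => ?_⟩
  rw [bracket, hx.2 g h hh, hy.2 g h hh, bracket, Ad_lie]

variable (I H) in
theorem isLieBracket_equivariantFunctions :
    IsLieBracket ℝ (A := equivariantFunctions I H)
      (fun x y => ⟨bracket x.1 y.1, bracket_mem_equivariantFunctions x.2 y.2⟩) :=
  have : CompleteSpace E := FiniteDimensional.complete ℝ E
  have hlie : IsLieBracket ℝ (fun v w : GroupLieAlgebra I G => ⁅v, w⁆) := isLieBracket_lie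
  { add_left _ _ _ := Subtype.ext (funext fun _ => hlie.add_left _ _ _)
    smul_left _ _ _ := Subtype.ext (funext fun _ => hlie.smul_left _ _ _)
    add_right _ _ _ := Subtype.ext (funext fun _ => hlie.add_right _ _ _)
    smul_right _ _ _ := Subtype.ext (funext fun _ => hlie.smul_right _ _ _)
    self _ := Subtype.ext (funext fun _ => hlie.self _)
    jacobi _ _ _ := Subtype.ext (funext fun _ => hlie.jacobi _ _ _) }

variable (I H) in
theorem isPostLie_equivariantFunctions [I.Boundaryless] :
    IsPostLie ℝ (A := equivariantFunctions I H)
      (fun x y => ⟨bracket x.1 y.1, bracket_mem_equivariantFunctions x.2 y.2⟩)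
      (fun x y => ⟨triangle x.1 y.1, triangle_mem_equivariantFunctions x.2 y.2⟩) :=
  have : CompleteSpace E := FiniteDimensional.complete ℝ E
  { lie := isLieBracket_equivariantFunctions I H
    add_left x y z := Subtype.ext (triangle_add_left x.1 y.1 z.2.1)
    smul_left c x y := Subtype.ext (triangle_smul_left c x.1 y.2.1)
    add_right x y z := Subtype.ext (triangle_add_right x.1 y.2.1 z.2.1)
    smul_right c x y := Subtype.ext (triangle_smul_right c x.1 y.2.1)
    derivation x y z := Subtype.ext (triangle_bracket_right x.1 y.2.1 z.2.1)
    bracket_tr x y z := Subtype.ext (triangle_bracket_left x.2.1 y.2.1 z.2.1) }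

end Equivariant

/-! ### Equivariant functions and sections of the Atiyah bundle -/

section AtiyahBundle

variable {E : Type*} [NormedAddCommGroup E] [NormedSpace ℝ E]
  {B : Type*} [TopologicalSpace B] {I : ModelWithCorners ℝ E B}
  {G : Type*} [TopologicalSpace G] [ChartedSpace B G] [Group G] [LieGroup I ∞ G]
  {M : Type*} [MulAction G M]

theorem AtiyahFiber.mk_eq_mk_iff {o u : M} {g k : G} (hg : g • o = u) (hk : k • o = u)
    (v w : GroupLieAlgebra I G) :
    AtiyahFiber.mk g hg v = AtiyahFiber.mk k hk w ↔ w = Ad (g⁻¹ * k)⁻¹ v := by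
  refine Subtype.ext_iff.trans (AtiyahBundle.mk_eq_iff.trans ⟨?_, fun h => ?_⟩)
  · rintro ⟨h, -, rfl, hw⟩
    rw [hw, inv_mul_cancel_left]
  · refine ⟨g⁻¹ * k, ?_, (mul_inv_cancel_left g k).symm, h⟩
    rw [MulAction.mem_stabilizer_iff, mul_smul, hk, ← hg, inv_smul_smul]

theorem AtiyahFiber.mk_equivariant {o : M} {x : G → GroupLieAlgebra I G}
    (hx : x ∈ equivariantFunctions I (MulAction.stabilizer G o)) {g k : G} {u : M}
    (hg : g • o = u) (hk : k • o = u) :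
    AtiyahFiber.mk g hg (x g) = AtiyahFiber.mk k hk (x k) := by
  rw [AtiyahFiber.mk_eq_mk_iff, ← hx.2 g (g⁻¹ * k), mul_inv_cancel_left]
  rw [MulAction.mem_stabilizer_iff, mul_smul, hk, ← hg, inv_smul_smul]

section Surjectivity

variable {o : M} {X : (u : M) → AtiyahFiber I G o u} {x : G → GroupLieAlgebra I G}

theorem eq_Ad_of_mk_eq (hx : ∀ g : G, AtiyahFiber.mk g rfl (x g) = X (g • o)) {g : G} {u : M}
    (hu : g • o = u) {k : G} (hk : k • o = u) {v : GroupLieAlgebra I G}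
    (hv : X u = AtiyahFiber.mk k hk v) : x g = Ad (g⁻¹ * k) v := by
  subst hu
  rw [(AtiyahFiber.mk_eq_mk_iff hk rfl v (x g)).1 (hv.symm.trans (hx g).symm), mul_inv_rev,
    inv_inv]

variable {E' : Type*} [NormedAddCommGroup E'] [NormedSpace ℝ E']
  {B' : Type*} [TopologicalSpace B'] {I' : ModelWithCorners ℝ E' B'}
  [TopologicalSpace M] [ChartedSpace B' M] [FiniteDimensional ℝ E] [FiniteDimensional ℝ E']
  [I.Boundaryless] [I'.Boundaryless] [SecondCountableTopology G] [IsManifold I' ∞ M]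
  [ContMDiffSMul I I' ∞ G M] [MulAction.IsPretransitive G M]

theorem mem_smoothFunctions_of_mk_eq (hX : IsSmoothSection I' X)
    (hx : ∀ g : G, AtiyahFiber.mk g rfl (x g) = X (g • o)) : x ∈ smoothFunctions I G := by
  intro g₀
  obtain ⟨U, σ, hU, hσ⟩ := exists_isCartanGauge I G I' o (g₀ • o)
  obtain ⟨f, hf, hXf⟩ := hX U σ hσ
  have horbit := contMDiff_orbitMap I G I' o
  have hUnhds : U ∈ 𝓝 (g₀ • o) := hσ.isOpen.mem_nhds hU
  have hgauge : ContMDiffAt I I ∞ (fun g => g⁻¹ * σ (g • o)) g₀ :=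
    contMDiffAt_id.inv.mul
      (ContMDiffAt.comp (I' := I') g₀ (hσ.smooth.contMDiffAt hUnhds) horbit.contMDiffAt)
  have hcoeff : ContMDiffAt I 𝓘(ℝ, E) ∞ (M' := E) (fun g => f (g • o)) g₀ :=
    ContMDiffAt.comp (I' := I') (M'' := E) g₀ (hf.contMDiffAt hUnhds) horbit.contMDiffAt
  refine ContMDiffAt.congr_of_eventuallyEq (M' := E)
    ((contMDiff_AdCLM.contMDiffAt.comp g₀ hgauge).clm_apply hcoeff) ?_
  filter_upwards [horbit.continuous.continuousAt.eventually_mem hUnhds] with g hg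
  exact eq_Ad_of_mk_eq hx rfl (hσ.smul_eq _ hg) (hXf _ _ hg)

theorem mem_equivariantFunctions_of_mk_eq (hX : IsSmoothSection I' X)
    (hx : ∀ g : G, AtiyahFiber.mk g rfl (x g) = X (g • o)) :
    x ∈ equivariantFunctions I (MulAction.stabilizer G o) := by
  refine ⟨mem_smoothFunctions_of_mk_eq hX hx, fun g h hh => ?_⟩
  rw [eq_Ad_of_mk_eq hx (by rw [mul_smul, MulAction.mem_stabilizer_iff.1 hh]) rfl (hx g).symm,
    mul_inv_rev, inv_mul_cancel_right]

end Surjectivity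

variable {E' : Type*} [NormedAddCommGroup E'] [NormedSpace ℝ E']
  {B' : Type*} [TopologicalSpace B'] {I' : ModelWithCorners ℝ E' B'}
  [TopologicalSpace M] [ChartedSpace B' M] [MulAction.IsPretransitive G M] {o : M}

variable (I' o) in
/-- The section `g • o ↦ [(g, x g)]` of the Atiyah bundle given by an equivariant function `x`.
Its value at `u` is computed from a chosen `g` with `g • o = u`. -/
def sectionOfEquivariant :
    equivariantFunctions (G := G) I (MulAction.stabilizer G o) →ₗ[ℝ] smoothSections I G I' o where
  toFun x :=
    ⟨fun u => AtiyahFiber.mk (MulAction.exists_smul_eq G o u).choose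
      (MulAction.exists_smul_eq G o u).choose_spec (x.1 _),
    fun _ σ hσ => ⟨fun u => x.1 (σ u),
      ContMDiff.comp_contMDiffOn (I' := I) (E'' := E) (I'' := 𝓘(ℝ, E)) x.2.1 hσ.smooth,
      fun _ hu _ => AtiyahFiber.mk_equivariant x.2 _ hu⟩⟩
  map_add' _ _ := Subtype.ext (funext fun _ => AtiyahFiber.mk_add _ _ _ _)
  map_smul' _ _ := Subtype.ext (funext fun _ => AtiyahFiber.mk_smul _ _ _ _)

theorem sectionOfEquivariant_apply
    (x : equivariantFunctions (G := G) I (MulAction.stabilizer G o)) {g : G} {u : M}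
    (hu : g • o = u) : (sectionOfEquivariant I' o x).1 u = AtiyahFiber.mk g hu (x.1 g) :=
  AtiyahFiber.mk_equivariant x.2 _ hu

variable (I G I' o) in
theorem sectionOfEquivariant_injective :
    Function.Injective (sectionOfEquivariant (I := I) (G := G) I' o) := by
  intro x y hxy
  refine Subtype.ext (funext fun g => (AtiyahFiber.mk_bijective g (rfl : g • o = g • o)).1 ?_)
  rw [← sectionOfEquivariant_apply (I' := I'), ← sectionOfEquivariant_apply (I' := I'), hxy]

variable (I G I' o) in
theorem sectionOfEquivariant_surjective [IsManifold I' ∞ M] [ContMDiffSMul I I' ∞ G M]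
    [I.Boundaryless] [I'.Boundaryless] [FiniteDimensional ℝ E] [FiniteDimensional ℝ E']
    [SecondCountableTopology G] :
    Function.Surjective (sectionOfEquivariant (I := I) (G := G) I' o) := by
  rintro ⟨X, hX⟩
  choose x hx using fun g : G =>
    (AtiyahFiber.mk_bijective (I := I) g (rfl : g • o = g • o)).2 (X (g • o))
  refine ⟨⟨x, mem_equivariantFunctions_of_mk_eq hX hx⟩, Subtype.ext (funext fun u => ?_)⟩
  obtain ⟨g, rfl⟩ := MulAction.exists_smul_eq G o u
  exact (sectionOfEquivariant_apply _ rfl).trans (hx g)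

end AtiyahBundle

end AtiyahPostLie

end

open AtiyahPostLie in
theorem mainTheorem8
    {E : Type*} [NormedAddCommGroup E] [NormedSpace ℝ E] [FiniteDimensional ℝ E]
    {B : Type*} [TopologicalSpace B] (I : ModelWithCorners ℝ E B) [I.Boundaryless]
    {G : Type*} [TopologicalSpace G] [ChartedSpace B G] [Group G] [LieGroup I ∞ G]
    [SecondCountableTopology G]
    {E' : Type*} [NormedAddCommGroup E'] [NormedSpace ℝ E'] [FiniteDimensional ℝ E']
    {B' : Type*} [TopologicalSpace B'] (I' : ModelWithCorners ℝ E' B') [I'.Boundaryless]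
    {M : Type*} [TopologicalSpace M] [ChartedSpace B' M] [IsManifold I' ∞ M]
    [MulAction G M] [ContMDiffSMul I I' ∞ G M] [MulAction.IsPretransitive G M]
    (o : M) :
    ∃ (hbr : ∀ x ∈ equivariantFunctions I (MulAction.stabilizer G o),
        ∀ y ∈ equivariantFunctions I (MulAction.stabilizer G o),
          bracket x y ∈ equivariantFunctions I (MulAction.stabilizer G o))
      (htr : ∀ x ∈ equivariantFunctions I (MulAction.stabilizer G o),
        ∀ y ∈ equivariantFunctions I (MulAction.stabilizer G o),
          triangle x y ∈ equivariantFunctions I (MulAction.stabilizer G o)),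
      IsPostLie ℝ (A := equivariantFunctions I (MulAction.stabilizer G o))
        (fun x y => ⟨bracket x.1 y.1, hbr x.1 x.2 y.1 y.2⟩)
        (fun x y => ⟨triangle x.1 y.1, htr x.1 x.2 y.1 y.2⟩) ∧
      ∃ Φ : equivariantFunctions I (MulAction.stabilizer G o) ≃ₗ[ℝ] smoothSections I G I' o,
        (∀ (x : equivariantFunctions I (MulAction.stabilizer G o)) (g : G) (u : M)
          (hu : g • o = u), (Φ x).1 u = AtiyahFiber.mk g hu (x.1 g)) ∧
        IsPostLie ℝ (A := smoothSections I G I' o)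
          (fun X Y => Φ ⟨bracket (Φ.symm X).1 (Φ.symm Y).1,
            hbr _ (Φ.symm X).2 _ (Φ.symm Y).2⟩)
          (fun X Y => Φ ⟨triangle (Φ.symm X).1 (Φ.symm Y).1,
            htr _ (Φ.symm X).2 _ (Φ.symm Y).2⟩) :=
  ⟨fun _ hx _ hy => bracket_mem_equivariantFunctions hx hy,
    fun _ hx _ hy => triangle_mem_equivariantFunctions hx hy,
    isPostLie_equivariantFunctions I _,
    LinearEquiv.ofBijective (sectionOfEquivariant I' o)
      ⟨sectionOfEquivariant_injective I G I' o, sectionOfEquivariant_surjective I G I' o⟩,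
    fun x _ _ hu => sectionOfEquivariant_apply x hu,
    (isPostLie_equivariantFunctions I _).transport _⟩
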